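/- Let $\eta=(\eta^{ij})$ ($N\times N$) and $\mu=(\mu^{mn})$ ($L\times L$) be constant nondegenerate symmetric real matrices, $(\eta_{ij})=(\eta^{ij})^{-1}$, and let $\psi_1,\dots,\psi_L$ be smooth functions on an open set $U\subseteq\mathbb R^N$ with coordinates $u=(u^1,\dots,u^N)$. Write $\partial_i=\partial/\partial u^i$; repeated indices are summed. Suppose that on $U$ $$\eta^{mn}\,\partial_i\partial_m\psi_j\,\partial_n\partial_l\psi_k=\eta^{mn}\,\partial_i\partial_m\psi_k\,\partial_n\partial_l\psi_j,\qquad \mu^{mn}\,\partial_i\partial_j\psi_m\,\partial_k\partial_l\psi_n=\mu^{mn}\,\partial_i\partial_k\psi_m\,\partial_j\partial_l\psi_n$$ for all values of the free indices. Consider the operators on fields $u(x)$ $$M_1^{ij}=\mu^{mn}\eta^{ip}\eta^{jr}\,\partial_p\partial_k\psi_m\,u^k_x\Big(\frac{d}{dx}\Big)^{-1}\!\circ\,\partial_r\partial_s\psi_n\,u^s_x,\qquad M_2^{ij}=\eta^{ij}\frac{d}{dx},\qquad R=M_1M_2^{-1}.$$ 1. $M_1$ and $M_2$ are compatible Hamiltonian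 operators: for all constants $a,b\in\mathbb R$ the operator $aM_1+bM_2$ (with $(d/dx)^{-1}=\frac12(\int_{-\infty}^x-\int_x^\infty)$ on compactly supported functions) defines, on smooth fields with values in $U$, a skew-symmetric bracket satisfying the Jacobi identity. Let moreover $V\subseteq U$ be any convex open set (every point of $U$ has such a neighbourhood). On $V$ consider, for smooth functions and starting from $h_1=\frac12\eta_{ij}u^iu^j$, the recursion relations for $s\ge1$ $$\partial_j\partial_p\psi_n\,\eta^{jr}\,\partial_r h_s=\partial_pF_n^{(s)}\quad(1\le n\le L),\qquad \mu^{mn}\,\partial_j\partial_k\psi_m\,F_n^{(s)}=\partial_j\partial_k h_{s+1}.$$ 2. The recursion is solvable on $V$ for every $s\ge1$: for every choice of the functions $F^{(1)}_n,h_2,\dots,F^{(s-1)}_n,h_s$ made in the preceding steps there are $F^{(s)}_n$ satisfying the first relation, and for every such $F^{(s)}_n$ there is $h_{s+1}$ satisfying the second. In particular solutions defined for all $s\ge 1$ exist. 3. Call an expression in the field local if it is a smooth function of $u\in V$ and finitely many $x$-derivatives of $u$, and let $(d/dx)^{-1}$ be taken in the class of local expressions, up to constants of integration. For every $s\ge0$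 the expression $R^su_x$ exists as a local expression, and for any choice of the integration constants it is of hydrodynamic type, $(R^su_x)^i=A^i_k(u)u^k_x$ with $A$ smooth on $V$, and $R$ can be applied to it again. 4. For every solution $(F_n^{(s)},h_s)_{s\ge1}$ of the recursion put $H_s=\int h_s(u)\,dx$, so that $\delta H_s/\delta u^j=\partial_jh_s$. Then for every $s\ge1$ the system of hydrodynamic type $$u^i_{t_s}=\mu^{mn}\eta^{ip}F_n^{(s)}(u)\,\partial_p\partial_k\psi_m\,u^k_x$$ is $u_{t_s}=R^su_x$ and is bi-Hamiltonian: $u^i_{t_s}=M_1^{ij}\,\delta H_s/\delta u^j=M_2^{ij}\,\delta H_{s+1}/\delta u^j$. These flows commute pairwise, and $\{H_p,H_r\}_1=\{H_p,H_r\}_2=0$ for all $p,r\ge1$, where $\{H,G\}_a=\int \frac{\delta H}{\delta u^i}M_a^{ij}\frac{\delta G}{\delta u^j}\,dx$ and an integral $\int q\,dx$ is zero when $q$ is the $x$-derivative of a local expression. -/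

import Mathlib

open scoped ContDiff

noncomputable section

namespace HydroHierarchy

/-- The space with flat coordinates `u = (u¹, …, u^N)`. -/
abbrev Coord (N : ℕ) : Type := Fin N → ℝ

/-- Expressions in a field `u = u(x)`: a `W`-valued function of `x` for each `u : ℝ → ℝ^N`. -/
abbrev FieldFun (N : ℕ) (W : Type) : Type := (ℝ → Coord N) → ℝ → W

/-- The partial derivative `∂f/∂u^i`. -/
def pd {N : ℕ} (i : Fin N) (f : Coord N → ℝ) : Coord N → ℝ :=
  fun u => fderiv ℝ f u (Pi.single i 1)

/-- The second partial derivative `∂²f/∂u^i∂u^j`. -/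
def pd2 {N : ℕ} (i j : Fin N) (f : Coord N → ℝ) : Coord N → ℝ :=
  pd i (pd j f)

/-- A smooth field `x ↦ u(x)` with values in `V`. -/
def IsField {N : ℕ} (V : Set (Coord N)) (u : ℝ → Coord N) : Prop :=
  ContDiff ℝ ∞ u ∧ ∀ x, u x ∈ V

/-! ### The nonlinear equations for the potentials `ψ_n` -/

/-- `η^{mn} ∂_i∂_mψ_j ∂_n∂_lψ_k = η^{mn} ∂_i∂_mψ_k ∂_n∂_lψ_j` on `U`. -/
def CommutingHessians {N L : ℕ} (U : Set (Coord N)) (η : Matrix (Fin N) (Fin N) ℝ)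
    (ψ : Fin L → Coord N → ℝ) : Prop :=
  ∀ u ∈ U, ∀ (j k : Fin L) (i l : Fin N),
    ∑ m, ∑ n, η m n * pd2 i m (ψ j) u * pd2 n l (ψ k) u =
      ∑ m, ∑ n, η m n * pd2 i m (ψ k) u * pd2 n l (ψ j) u

/-- `μ^{mn} ∂_i∂_jψ_m ∂_k∂_lψ_n = μ^{mn} ∂_i∂_kψ_m ∂_j∂_lψ_n` on `U`. -/
def GaussEquations {N L : ℕ} (U : Set (Coord N)) (μ : Matrix (Fin L) (Fin L) ℝ)
    (ψ : Fin L → Coord N → ℝ) : Prop :=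
  ∀ u ∈ U, ∀ i j k l : Fin N,
    ∑ m, ∑ n, μ m n * pd2 i j (ψ m) u * pd2 k l (ψ n) u =
      ∑ m, ∑ n, μ m n * pd2 i k (ψ m) u * pd2 j l (ψ n) u

/-! ### The recursion for the functions `F_n^{(s)}` and the densities `h_s` -/

/-- `F_n`, smooth on `V`, solve `∂_j∂_pψ_n η^{jr} ∂_r h = ∂_p F_n` on `V`. -/
def SolvesF {N L : ℕ} (V : Set (Coord N)) (η : Matrix (Fin N) (Fin N) ℝ)
    (ψ : Fin L → Coord N → ℝ) (h : Coord N → ℝ) (F : Fin L → Coord N → ℝ) : Prop :=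
  (∀ n, ContDiffOn ℝ ∞ (F n) V) ∧
  ∀ u ∈ V, ∀ (n : Fin L) (p : Fin N),
    ∑ j, ∑ r, pd2 j p (ψ n) u * η j r * pd r h u = pd p (F n) u

/-- `h'`, smooth on `V`, solves `μ^{mn} ∂_j∂_kψ_m F_n = ∂_j∂_k h'` on `V`. -/
def SolvesH {N L : ℕ} (V : Set (Coord N)) (μ : Matrix (Fin L) (Fin L) ℝ)
    (ψ : Fin L → Coord N → ℝ) (F : Fin L → Coord N → ℝ) (h' : Coord N → ℝ) : Prop :=
  ContDiffOn ℝ ∞ h' V ∧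
  ∀ u ∈ V, ∀ j k : Fin N,
    ∑ m, ∑ n, μ m n * pd2 j k (ψ m) u * F n u = pd2 j k h' u

/-- `F^{(1)}, …, F^{(K)}` and `h_1, …, h_{K+1}` satisfy the recursion on `V`, where
`h_1 = ½ η_{ij} u^i u^j` and `(η_{ij})` is the inverse of `(η^{ij})`.
Values `F 0` and `h 0` play no role. -/
def SolvesUpTo {N L : ℕ} (V : Set (Coord N)) (η : Matrix (Fin N) (Fin N) ℝ)
    (μ : Matrix (Fin L) (Fin L) ℝ) (ψ : Fin L → Coord N → ℝ) (K : ℕ)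
    (F : ℕ → Fin L → Coord N → ℝ) (h : ℕ → Coord N → ℝ) : Prop :=
  (∀ u ∈ V, h 1 u = (1 / 2) * ∑ i, ∑ j, η⁻¹ i j * u i * u j) ∧
  ∀ s, 1 ≤ s → s ≤ K → SolvesF V η ψ (h s) (F s) ∧ SolvesH V μ ψ (F s) (h (s + 1))

/-- The whole infinite recursion, for all `s ≥ 1`. -/
def SolvesRecursion {N L : ℕ} (V : Set (Coord N)) (η : Matrix (Fin N) (Fin N) ℝ)
    (μ : Matrix (Fin L) (Fin L) ℝ) (ψ : Fin L → Coord N → ℝ)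
    (F : ℕ → Fin L → Coord N → ℝ) (h : ℕ → Coord N → ℝ) : Prop :=
  ∀ K, SolvesUpTo V η μ ψ K F h

/-! ### Local expressions (differential functions) and the formal `d/dx` -/

/-- `P[u](x) = f(u(x), u_x(x), …, u^{(k)}(x))` for some finite `k` and some smooth `f`, on all
fields with values in `V`. -/
def IsLocal {N : ℕ} {W : Type} [NormedAddCommGroup W] [NormedSpace ℝ W]
    (V : Set (Coord N)) (P : FieldFun N W) : Prop :=
  ∃ (k : ℕ) (f : (Fin (k + 1) → Coord N) → W),
    ContDiffOn ℝ ∞ f {J | J 0 ∈ V} ∧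
    ∀ u, IsField V u → ∀ x, P u x = f (fun a => iteratedDeriv (a : ℕ) u x)

/-- `(d/dx) Q = P` on all fields with values in `V`. -/
def IsTotalDeriv {N : ℕ} {W : Type} [NormedAddCommGroup W] [NormedSpace ℝ W]
    (V : Set (Coord N)) (Q P : FieldFun N W) : Prop :=
  ∀ u, IsField V u → ∀ x, HasDerivAt (Q u) (P u x) x

/-- `Q` is a value of `(d/dx)⁻¹ P` in the class of local expressions (it is determined by `P`
only up to an integration constant). -/
def IsInvDx {N : ℕ} {W : Type} [NormedAddCommGroup W] [NormedSpace ℝ W]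
    (V : Set (Coord N)) (P Q : FieldFun N W) : Prop :=
  IsLocal V Q ∧ IsTotalDeriv V Q P

/-- The functional `∫ q dx` vanishes: `q` is the total `x`-derivative of a local expression. -/
def IsNullDensity {N : ℕ} (V : Set (Coord N)) (q : FieldFun N ℝ) : Prop :=
  ∃ Q : FieldFun N ℝ, IsInvDx V q Q

/-- A local expression of hydrodynamic type, `Y^i = A^i_k(u) u^k_x`, with `A` smooth on `V`. -/
def IsHydrodynamic {N : ℕ} (V : Set (Coord N)) (Y : FieldFun N (Coord N)) : Prop :=
  ∃ A : Fin N → Fin N → Coord N → ℝ,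
    (∀ i k, ContDiffOn ℝ ∞ (A i k) V) ∧
    ∀ u, IsField V u → ∀ x i, Y u x i = ∑ k, A i k (u x) * deriv u x k

/-- The variational derivative `δH/δu^j = ∂h/∂u^j` of `H = ∫ h(u) dx`
(the density `h` does not involve derivatives of `u`). -/
def varDeriv {N : ℕ} (h : Coord N → ℝ) : FieldFun N (Coord N) :=
  fun u x j => pd j h (u x)

/-! ### The operators `M₁`, `M₂`, and the recursion operator `R = M₁ M₂⁻¹`

`M₁^{ij} = μ^{mn} η^{ip} η^{jr} ∂_p∂_kψ_m u^k_x (d/dx)⁻¹ ∘ ∂_r∂_sψ_n u^s_x` and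
`M₂^{ij} = η^{ij} d/dx`. -/

/-- The right factor of `M₁`: `η^{jr} ∂_r∂_sψ_n u^s_x ξ_j`. -/
def rightFactor {N L : ℕ} (η : Matrix (Fin N) (Fin N) ℝ) (ψ : Fin L → Coord N → ℝ)
    (u ξ : ℝ → Coord N) (n : Fin L) (x : ℝ) : ℝ :=
  ∑ j, ∑ r, ∑ s, η j r * pd2 r s (ψ n) (u x) * deriv u x s * ξ x j

/-- The left factor of `M₁`: `μ^{mn} η^{ip} ∂_p∂_kψ_m u^k_x P_n`. -/
def leftFactor {N L : ℕ} (η : Matrix (Fin N) (Fin N) ℝ) (μ : Matrix (Fin L) (Fin L) ℝ)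
    (ψ : Fin L → Coord N → ℝ) (u : ℝ → Coord N) (P : Fin L → ℝ → ℝ) (x : ℝ) : Coord N :=
  fun i => ∑ m, ∑ n, ∑ p, ∑ k, μ m n * η i p * pd2 p k (ψ m) (u x) * deriv u x k * P n x

/-- `Y` is a (local) value of `M₁ G`. -/
def IsM1Value {N L : ℕ} (V : Set (Coord N)) (η : Matrix (Fin N) (Fin N) ℝ)
    (μ : Matrix (Fin L) (Fin L) ℝ) (ψ : Fin L → Coord N → ℝ)
    (G Y : FieldFun N (Coord N)) : Prop :=
  ∃ P : Fin L → FieldFun N ℝ,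
    (∀ n, IsInvDx V (fun u x => rightFactor η ψ u (G u) n x) (P n)) ∧
    ∀ u, IsField V u → ∀ x, Y u x = leftFactor η μ ψ u (fun n => P n u) x

/-- `Y = M₂ G`. -/
def IsM2Value {N : ℕ} (V : Set (Coord N)) (η : Matrix (Fin N) (Fin N) ℝ)
    (G Y : FieldFun N (Coord N)) : Prop :=
  IsTotalDeriv V (fun u x => η.mulVec (G u x)) Y

/-- `Y'` is a (local) value of `R Y = M₁ M₂⁻¹ Y`. -/
def IsRValue {N L : ℕ} (V : Set (Coord N)) (η : Matrix (Fin N) (Fin N) ℝ)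
    (μ : Matrix (Fin L) (Fin L) ℝ) (ψ : Fin L → Coord N → ℝ)
    (Y Y' : FieldFun N (Coord N)) : Prop :=
  ∃ G : FieldFun N (Coord N), IsLocal V G ∧ IsM2Value V η G Y ∧ IsM1Value V η μ ψ G Y'

/-- `Y` is a (local) value of `R^s u_x`. -/
def IsRPowValue {N L : ℕ} (V : Set (Coord N)) (η : Matrix (Fin N) (Fin N) ℝ)
    (μ : Matrix (Fin L) (Fin L) ℝ) (ψ : Fin L → Coord N → ℝ) :
    ℕ → FieldFun N (Coord N) → Prop
  | 0, Y => ∀ u, IsField V u → ∀ x, Y u x = deriv u x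
  | s + 1, Y => ∃ Y', IsRPowValue V η μ ψ s Y' ∧ IsRValue V η μ ψ Y' Y

/-- The right-hand side `μ^{mn} η^{ip} F_n(u) ∂_p∂_kψ_m u^k_x` of a flow of the hierarchy. -/
def flow {N L : ℕ} (η : Matrix (Fin N) (Fin N) ℝ) (μ : Matrix (Fin L) (Fin L) ℝ)
    (ψ : Fin L → Coord N → ℝ) (F : Fin L → Coord N → ℝ) : FieldFun N (Coord N) :=
  fun u x i =>
    ∑ m, ∑ n, ∑ p, ∑ k, μ m n * η i p * F n (u x) * pd2 p k (ψ m) (u x) * deriv u x k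

/-- `{∫ h dx, ∫ g dx} = ∫ (δH/δu^i) M^{ij} (δG/δu^j) dx = 0`, where `M` is given by its graph:
`M δG` has a local value, and every such value gives the zero functional. -/
def InInvolution {N : ℕ} (V : Set (Coord N))
    (M : FieldFun N (Coord N) → FieldFun N (Coord N) → Prop) (h g : Coord N → ℝ) : Prop :=
  (∃ Y, M (varDeriv g) Y) ∧
  ∀ Y, M (varDeriv g) Y → IsNullDensity V (fun u x => ∑ i, varDeriv h u x i * Y u x i)

/-- The flows `u_t = Y[u]` and `u_τ = Z[u]` commute: the derivative of `Y` along `Z` equals the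
derivative of `Z` along `Y`. -/
def FlowsCommute {N : ℕ} (V : Set (Coord N)) (Y Z : FieldFun N (Coord N)) : Prop :=
  ∀ u, IsField V u → ∀ x, ∃ d : Coord N,
    HasDerivAt (fun ε : ℝ => Y (u + ε • Z u) x) d 0 ∧
    HasDerivAt (fun ε : ℝ => Z (u + ε • Y u) x) d 0

/-! ### Hamiltonian operators -/

/-- A smooth compactly supported covector field along the `x`-axis. -/
def IsTest {N : ℕ} (ξ : ℝ → Coord N) : Prop :=
  ContDiff ℝ ∞ ξ ∧ HasCompactSupport ξ

/-- `∫ ξ_i(x) v^i(x) dx`. -/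
def pairing {N : ℕ} (ξ v : ℝ → Coord N) : ℝ :=
  ∫ x, ∑ i, ξ x i * v x i

/-- The skew-symmetric antiderivative `½ (∫_{-∞}^x - ∫_x^∞)` of compactly supported functions. -/
def skewInt (f : ℝ → ℝ) (x : ℝ) : ℝ :=
  (1 / 2) * ((∫ y in Set.Iic x, f y) - ∫ y in Set.Ioi x, f y)

/-- `M₁` at the field `u`, applied to a test covector field. -/
def M1op {N L : ℕ} (η : Matrix (Fin N) (Fin N) ℝ) (μ : Matrix (Fin L) (Fin L) ℝ)
    (ψ : Fin L → Coord N → ℝ) (u ξ : ℝ → Coord N) : ℝ → Coord N :=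
  leftFactor η μ ψ u (fun n => skewInt (rightFactor η ψ u ξ n))

/-- `M₂` (which does not depend on the field), applied to a test covector field. -/
def M2op {N : ℕ} (η : Matrix (Fin N) (Fin N) ℝ) (ξ : ℝ → Coord N) : ℝ → Coord N :=
  fun x => η.mulVec (deriv ξ x)

/-- `P` is Hamiltonian on the fields with values in `U`: the bracket
`{I_ξ, I_ζ}[u] = ∫ ξ_i (P_u ζ)^i dx` of the functionals `I_ξ[u] = ∫ ξ_i u^i dx` is skew-symmetric
and satisfies the Jacobi identity. Here `{{I_1, I_2}, I_3}` is the derivative of `{I_1, I_2}`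
along the Hamiltonian vector field `P_u ξ_3` of `I_3`. -/
def IsHamiltonian {N : ℕ} (U : Set (Coord N))
    (P : (ℝ → Coord N) → (ℝ → Coord N) → (ℝ → Coord N)) : Prop :=
  ∀ u, IsField U u →
    (∀ ξ ζ, IsTest ξ → IsTest ζ → pairing ξ (P u ζ) = -pairing ζ (P u ξ)) ∧
    ∀ ξ₁ ξ₂ ξ₃, IsTest ξ₁ → IsTest ξ₂ → IsTest ξ₃ →
      ∃ a b c : ℝ,
        HasDerivAt (fun ε : ℝ => pairing ξ₁ (P (u + ε • P u ξ₃) ξ₂)) a 0 ∧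
        HasDerivAt (fun ε : ℝ => pairing ξ₂ (P (u + ε • P u ξ₁) ξ₃)) b 0 ∧
        HasDerivAt (fun ε : ℝ => pairing ξ₃ (P (u + ε • P u ξ₂) ξ₁)) c 0 ∧
        a + b + c = 0

end HydroHierarchy

end

/-! Write `Ψ_n` for the Hessian of `ψ_n`. The first hypothesis says `Ψ_j η Ψ_k = Ψ_k η Ψ_j`. The
second, contracted with four vectors, says that `μ^{mn} Ψ_m(a,b) Ψ_n(c,d)` is unchanged when `b` and
`c` are exchanged (`Setting.swap`). Everything below is one of these two symmetries.

Recursion. Call a density `h` admissible if `Ψ_n η Hess h = Hess h η Ψ_n` for all `n`. This makes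
the matrix `Ψ_n η Hess h` symmetric, which is the closedness of the 1-form `Ψ_n η ∇h`; on a convex
set it therefore equals some `dF_n`. The Gauss equations make the forms `μ^{mn} F_n d(∂_k ψ_m)`
closed, and symmetry of Hessians makes their primitives the components of a gradient `∇h'`. Then
`Hess h' = μ^{mn} F_n Ψ_m` is a combination of the `Ψ_m`, so `h'` is again admissible. The initial
density has Hessian `η⁻¹`, which is admissible trivially.

Flows. The flow of `F` is `η (∇h')_x`. Local antiderivatives are unique up to constants
(`IsLocal.eq_add_const`); the constants in `M₂⁻¹` add a linear function to the density and those in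
`M₁` add constants to `F`, so every value of `R^s u_x` has the form `η (∇h)_x` with `h` admissible.
All Hessians of the hierarchy commute through `η`, which gives commuting flows and involution for
`M₂`; involution for `M₁` follows from the Gauss equations.

Hamiltonian property. The derivative of `⟨ξ, M₁ ζ⟩` along `v` has a density which, up to the
`x`-derivative of a compactly supported function, is a remainder built from the matrices `A_ξ =
μ^{mn} R_n Ψ_m`, where `R_n` is the skew antiderivative of the right factor of `ξ`
(`hasDerivAt_varPrimitive`). For `v = a M₁θ + b M₂θ` the cyclic sum of remainders vanishes because
these matrices are symmetric and commute through `η` (`cyclic_sum_eq_zero`). -/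

namespace HydroHierarchy

/-! ### Partial derivatives and primitives of closed 1-forms on convex sets. -/

section

variable {N L : ℕ}

/-- The gradient of `f` as a vector. -/
noncomputable def grad (f : Coord N → ℝ) (u : Coord N) : Coord N := fun i => pd i f u

/-- The Hessian matrix of `f`. -/
noncomputable def hess (f : Coord N → ℝ) (u : Coord N) : Matrix (Fin N) (Fin N) ℝ :=
  fun i j => pd2 i j f u

theorem fderiv_eq_sum_pd (f : Coord N → ℝ) (u v : Coord N) :
    fderiv ℝ f u v = ∑ i, pd i f u * v i := by
  conv_lhs => rw [← Finset.univ_sum_single v]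
  rw [map_sum]
  refine Finset.sum_congr rfl fun i _ => ?_
  have : (Pi.single i (v i) : Coord N) = v i • Pi.single i 1 := by
    rw [← Pi.single_smul, smul_eq_mul, mul_one]
  rw [this, map_smul, smul_eq_mul, mul_comm, pd]

theorem contDiffOn_pd {U : Set (Coord N)} (hU : IsOpen U) {f : Coord N → ℝ}
    (hf : ContDiffOn ℝ ∞ f U) (i : Fin N) : ContDiffOn ℝ ∞ (pd i f) U :=
  (hf.fderiv_of_isOpen hU (m := ∞) (by simp)).clm_apply contDiffOn_const

theorem contDiffOn_pd2 {U : Set (Coord N)} (hU : IsOpen U) {f : Coord N → ℝ}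
    (hf : ContDiffOn ℝ ∞ f U) (i j : Fin N) : ContDiffOn ℝ ∞ (pd2 i j f) U :=
  contDiffOn_pd hU (contDiffOn_pd hU hf j) i

theorem differentiableAt_of_contDiffOn {E : Type*} [NormedAddCommGroup E] [NormedSpace ℝ E]
    {U : Set E} (hU : IsOpen U) {f : E → ℝ}
    (hf : ContDiffOn ℝ ∞ f U) {u : E} (hu : u ∈ U) : DifferentiableAt ℝ f u :=
  (hf.differentiableOn (by simp)).differentiableAt (hU.mem_nhds hu)

theorem pd2_symm {U : Set (Coord N)} (hU : IsOpen U) {f : Coord N → ℝ}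
    (hf : ContDiffOn ℝ ∞ f U) {u : Coord N} (hu : u ∈ U) (i j : Fin N) :
    pd2 i j f u = pd2 j i f u := by
  have hd : DifferentiableAt ℝ (fderiv ℝ f) u :=
    ((hf.fderiv_of_isOpen hU (m := ∞) (by simp)).differentiableOn (by simp)).differentiableAt
      (hU.mem_nhds hu)
  have key : ∀ i j : Fin N, pd2 i j f u
      = fderiv ℝ (fderiv ℝ f) u (Pi.single i 1) (Pi.single j 1) := by
    intro i j
    change fderiv ℝ (fun u => fderiv ℝ f u (Pi.single j 1)) u (Pi.single i 1) = _
    rw [fderiv_clm_apply hd (differentiableAt_const _)]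
    simp
  rw [key, key]
  exact (hf.contDiffAt (hU.mem_nhds hu)).isSymmSndFDerivAt (by
    rw [minSmoothness_of_isRCLikeNormedField]; exact ENat.LEInfty.out) _ _

theorem pd_congr {U : Set (Coord N)} (hU : IsOpen U) {f g : Coord N → ℝ}
    (h : ∀ u ∈ U, f u = g u) {u : Coord N} (hu : u ∈ U) (i : Fin N) : pd i f u = pd i g u := by
  have : f =ᶠ[nhds u] g := Filter.eventually_of_mem (hU.mem_nhds hu) h
  rw [pd, pd, this.fderiv_eq]

theorem pd2_congr {U : Set (Coord N)} (hU : IsOpen U) {f g : Coord N → ℝ}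
    (h : ∀ u ∈ U, f u = g u) {u : Coord N} (hu : u ∈ U) (i j : Fin N) :
    pd2 i j f u = pd2 i j g u :=
  pd_congr hU (fun _ hv => pd_congr hU h hv j) hu i

theorem pd_mul {f g : Coord N → ℝ} {u : Coord N} (hf : DifferentiableAt ℝ f u)
    (hg : DifferentiableAt ℝ g u) (i : Fin N) :
    pd i (fun v => f v * g v) u = pd i f u * g u + f u * pd i g u := by
  rw [pd, pd, pd, fderiv_fun_mul hf hg]
  simp
  ring

theorem pd_sum {ι : Type*} [Fintype ι] {f : ι → Coord N → ℝ} {u : Coord N}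
    (hf : ∀ a, DifferentiableAt ℝ (f a) u) (i : Fin N) :
    pd i (fun v => ∑ a, f a v) u = ∑ a, pd i (f a) u := by
  rw [pd, fderiv_fun_sum fun a _ => hf a]
  simp [pd]

theorem pd_add {f g : Coord N → ℝ} {u : Coord N}
    (hf : DifferentiableAt ℝ f u) (hg : DifferentiableAt ℝ g u) (i : Fin N) :
    pd i (fun v => f v + g v) u = pd i f u + pd i g u := by
  rw [pd, fderiv_fun_add hf hg]
  rfl

theorem pd_const (c : ℝ) (u : Coord N) (i : Fin N) : pd i (fun _ => c) u = 0 := by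
  simp [pd]

theorem pd_const_mul {f : Coord N → ℝ} {u : Coord N} (hf : DifferentiableAt ℝ f u) (c : ℝ)
    (i : Fin N) : pd i (fun v => c * f v) u = c * pd i f u := by
  rw [pd, fderiv_const_mul hf]
  rfl

theorem pd_coord (j i : Fin N) (u : Coord N) :
    pd i (fun v => v j) u = (1 : Matrix (Fin N) (Fin N) ℝ) j i := by
  have : HasFDerivAt (fun v : Coord N => v j) (ContinuousLinearMap.proj j) u :=
    (ContinuousLinearMap.proj (R := ℝ) (φ := fun _ : Fin N => ℝ) j).hasFDerivAt
  rw [pd, this.fderiv]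
  simp [Pi.single_apply, Matrix.one_apply]

/-- The chain rule along a curve. -/
theorem hasDerivAt_comp_curve {f : Coord N → ℝ} {γ : ℝ → Coord N} {γ' : Coord N} {x : ℝ}
    (hf : DifferentiableAt ℝ f (γ x)) (hγ : HasDerivAt γ γ' x) :
    HasDerivAt (fun y => f (γ y)) (∑ i, pd i f (γ x) * γ' i) x := by
  rw [← fderiv_eq_sum_pd]
  exact hf.hasFDerivAt.comp_hasDerivAt x hγ

/-- A closed smooth 1-form on a convex open set is exact. -/
theorem exists_primitive {V : Set (Coord N)} (hV : IsOpen V) (hc : Convex ℝ V)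
    {θ : Fin N → Coord N → ℝ} (hθ : ∀ p, ContDiffOn ℝ ∞ (θ p) V)
    (hsymm : ∀ u ∈ V, ∀ p q, pd q (θ p) u = pd p (θ q) u) :
    ∃ Q : Coord N → ℝ, ContDiffOn ℝ ∞ Q V ∧ ∀ u ∈ V, ∀ p, pd p Q u = θ p u := by
  let π : Fin N → Coord N →L[ℝ] ℝ := fun p =>
    ContinuousLinearMap.proj (R := ℝ) (φ := fun _ : Fin N => ℝ) p
  let Ω : Coord N → Coord N →L[ℝ] ℝ := fun u => ∑ p, θ p u • π p
  have hΩ : ContDiffOn ℝ ∞ Ω V :=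
    ContDiffOn.sum fun p _ => (hθ p).smul contDiffOn_const
  have hd : ∀ u ∈ V, ∀ x y, fderiv ℝ Ω u x y = ∑ p, ∑ q, pd q (θ p) u * x q * y p := by
    intro u hu x y
    have h1 : HasFDerivAt Ω (∑ p, (fderiv ℝ (θ p) u).smulRight (π p)) u :=
      HasFDerivAt.fun_sum fun p _ =>
        (differentiableAt_of_contDiffOn hV (hθ p) hu).hasFDerivAt.smul_const (π p)
    rw [h1.fderiv]
    simp [π, fderiv_eq_sum_pd, Finset.sum_mul]
  obtain ⟨Q, hQ⟩ := hc.exists_forall_hasFDerivAt_of_fderiv_symmetric hV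
    (hΩ.differentiableOn (by simp)) (fun u hu x y => by
      rw [hd u hu, hd u hu, Finset.sum_comm]
      refine Finset.sum_congr rfl fun p _ => Finset.sum_congr rfl fun q _ => ?_
      rw [hsymm u hu]; ring)
  refine ⟨Q, ?_, fun u hu p => ?_⟩
  -- The primitive is smooth because its derivative is the smooth form `Ω`.
  · rw [contDiffOn_infty_iff_fderiv_of_isOpen hV]
    exact ⟨fun u hu => (hQ u hu).differentiableAt.differentiableWithinAt,
      hΩ.congr fun u hu => (hQ u hu).fderiv⟩
  · rw [pd, (hQ u hu).fderiv]
    simp [Ω, π, Pi.single_apply]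

/-- The form `∑ f_a dg_a` is exact as soon as `∑ df_a ∧ dg_a = 0`. -/
theorem exists_primitive_sum_mul_pd {ι : Type*} [Fintype ι] {V : Set (Coord N)} (hV : IsOpen V)
    (hc : Convex ℝ V) {f g : ι → Coord N → ℝ} (hf : ∀ a, ContDiffOn ℝ ∞ (f a) V)
    (hg : ∀ a, ContDiffOn ℝ ∞ (g a) V)
    (hsymm : ∀ u ∈ V, ∀ p q, ∑ a, pd q (f a) u * pd p (g a) u = ∑ a, pd p (f a) u * pd q (g a) u) :
    ∃ Q : Coord N → ℝ, ContDiffOn ℝ ∞ Q V ∧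
      ∀ u ∈ V, ∀ p, pd p Q u = ∑ a, f a u * pd p (g a) u := by
  refine exists_primitive hV hc
    (fun p => ContDiffOn.sum fun a _ => (hf a).mul (contDiffOn_pd hV (hg a) p)) ?_
  have key : ∀ u ∈ V, ∀ p q, pd q (fun v => ∑ a, f a v * pd p (g a) v) u =
      ∑ a, pd q (f a) u * pd p (g a) u + ∑ a, f a u * pd2 q p (g a) u := by
    intro u hu p q
    have h1 := fun a => differentiableAt_of_contDiffOn hV (hf a) hu
    have h2 := fun a => differentiableAt_of_contDiffOn hV (contDiffOn_pd hV (hg a) p) hu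
    rw [pd_sum fun a => (h1 a).fun_mul (h2 a), ← Finset.sum_add_distrib]
    exact Finset.sum_congr rfl fun a _ => pd_mul (h1 a) (h2 a) q
  intro u hu p q
  rw [key u hu, key u hu, hsymm u hu]
  congr 1
  exact Finset.sum_congr rfl fun a _ => by rw [pd2_symm hV (hg a) hu]

end

/-! ### The two symmetries and the solvability of the recursion. -/

section

variable {N L : ℕ}

open Matrix

/-- The contraction `μ^{mn} x_m y_n`. -/
def contract (μ : Matrix (Fin L) (Fin L) ℝ) (x y : Fin L → ℝ) : ℝ :=
  ∑ m, ∑ n, μ m n * x m * y n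

/-- The bilinear form `a_i H_{ij} b_j`. -/
def form (H : Matrix (Fin N) (Fin N) ℝ) (a b : Coord N) : ℝ := a ⬝ᵥ (H *ᵥ b)

theorem form_comm {H : Matrix (Fin N) (Fin N) ℝ} (hH : H.IsSymm) (a b : Coord N) :
    form H a b = form H b a := by
  unfold form
  rw [dotProduct_mulVec, dotProduct_comm, ← mulVec_transpose, hH.eq]

theorem form_eq_sum (H : Matrix (Fin N) (Fin N) ℝ) (a b : Coord N) :
    form H a b = ∑ i, ∑ j, H i j * (a i * b j) := by
  simp only [form, dotProduct, mulVec, Finset.mul_sum]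
  exact Finset.sum_congr rfl fun i _ => Finset.sum_congr rfl fun j _ => by ring

theorem form_single_left (H : Matrix (Fin N) (Fin N) ℝ) (i : Fin N) (b : Coord N) :
    form H (Pi.single i 1) b = (H *ᵥ b) i := by
  simp [form]

theorem form_single_single (H : Matrix (Fin N) (Fin N) ℝ) (i j : Fin N) :
    form H (Pi.single i 1) (Pi.single j 1) = H i j := by
  simp [form]

theorem sum_rotate {α β γ : Type*} [Fintype α] [Fintype β] [Fintype γ] (f : α → β → γ → ℝ) :
    ∑ a, ∑ b, ∑ c, f a b c = ∑ c, ∑ a, ∑ b, f a b c := by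
  rw [Finset.sum_congr rfl fun a _ => Finset.sum_comm, Finset.sum_comm]

theorem contract_form_expand (μ : Matrix (Fin L) (Fin L) ℝ)
    (H : Fin L → Matrix (Fin N) (Fin N) ℝ) (a b c d : Coord N) :
    contract μ (fun m => form (H m) a b) (fun n => form (H n) c d) =
      ∑ i, ∑ j, ∑ k, ∑ l, (∑ m, ∑ n, μ m n * H m i j * H n k l) * (a i * b j * c k * d l) := by
  simp only [contract, form_eq_sum, Finset.mul_sum, Finset.sum_mul]
  have h : ∀ f : Fin L → Fin L → Fin N → Fin N → Fin N → Fin N → ℝ,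
      ∑ m, ∑ n, ∑ k, ∑ l, ∑ i, ∑ j, f m n i j k l =
        ∑ i, ∑ j, ∑ k, ∑ l, ∑ m, ∑ n, f m n i j k l := by
    intro f
    calc _ = ∑ k, ∑ l, ∑ m, ∑ n, ∑ i, ∑ j, f m n i j k l := by
          rw [sum_rotate]
          exact Finset.sum_congr rfl fun k _ => sum_rotate _
      _ = ∑ k, ∑ l, ∑ i, ∑ j, ∑ m, ∑ n, f m n i j k l := by
          refine Finset.sum_congr rfl fun k _ => Finset.sum_congr rfl fun l _ => ?_
          rw [sum_rotate]
          exact Finset.sum_congr rfl fun i _ => sum_rotate _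
      _ = _ := by
          rw [sum_rotate]
          exact Finset.sum_congr rfl fun i _ => sum_rotate _
  rw [h]
  simp only [← mul_assoc]
  refine Finset.sum_congr rfl fun i _ => Finset.sum_congr rfl fun j _ =>
    Finset.sum_congr rfl fun k _ => Finset.sum_congr rfl fun l _ =>
    Finset.sum_congr rfl fun m _ => Finset.sum_congr rfl fun n _ => by ring

/-- The Gauss equations, contracted with four vectors. -/
theorem contract_form_swap {μ : Matrix (Fin L) (Fin L) ℝ}
    {H : Fin L → Matrix (Fin N) (Fin N) ℝ}
    (hG : ∀ i j k l, ∑ m, ∑ n, μ m n * H m i j * H n k l = ∑ m, ∑ n, μ m n * H m i k * H n j l)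
    (a b c d : Coord N) :
    contract μ (fun m => form (H m) a b) (fun n => form (H n) c d) =
      contract μ (fun m => form (H m) a c) (fun n => form (H n) b d) := by
  rw [contract_form_expand, contract_form_expand]
  refine Finset.sum_congr rfl fun i _ => ?_
  rw [Finset.sum_comm]
  refine Finset.sum_congr rfl fun k _ => Finset.sum_congr rfl fun j _ =>
    Finset.sum_congr rfl fun l _ => ?_
  rw [hG]; ring

theorem hess_isSymm {U : Set (Coord N)} (hU : IsOpen U) {f : Coord N → ℝ}
    (hf : ContDiffOn ℝ ∞ f U) {u : Coord N} (hu : u ∈ U) : (hess f u).IsSymm :=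
  Matrix.IsSymm.ext fun i j => pd2_symm hU hf hu j i

theorem CommutingHessians.mul_comm {U : Set (Coord N)} {η : Matrix (Fin N) (Fin N) ℝ}
    {ψ : Fin L → Coord N → ℝ} (h : CommutingHessians U η ψ) {u : Coord N} (hu : u ∈ U)
    (j k : Fin L) :
    hess (ψ j) u * η * hess (ψ k) u = hess (ψ k) u * η * hess (ψ j) u := by
  have key : ∀ (j k : Fin L) (i l : Fin N), (hess (ψ j) u * η * hess (ψ k) u) i l =
      ∑ m, ∑ n, η m n * pd2 i m (ψ j) u * pd2 n l (ψ k) u := by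
    intro j k i l
    simp only [Matrix.mul_apply, Finset.sum_mul, hess]
    rw [Finset.sum_comm]
    exact Finset.sum_congr rfl fun m _ => Finset.sum_congr rfl fun n _ => by ring
  ext i l
  rw [key, key, h u hu]

/-- A smooth density on `V` whose Hessian commutes with those of the potentials. -/
def Admissible (V : Set (Coord N)) (η : Matrix (Fin N) (Fin N) ℝ) (ψ : Fin L → Coord N → ℝ)
    (h : Coord N → ℝ) : Prop :=
  ContDiffOn ℝ ∞ h V ∧ ∀ u ∈ V, ∀ n,
    hess (ψ n) u * η * hess h u = hess h u * η * hess (ψ n) u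

/-- The standing hypotheses on a convex open part of the domain. -/
structure Setting (V : Set (Coord N)) (η : Matrix (Fin N) (Fin N) ℝ)
    (μ : Matrix (Fin L) (Fin L) ℝ) (ψ : Fin L → Coord N → ℝ) : Prop where
  symm_η : η.IsSymm
  det_η : η.det ≠ 0
  symm_μ : μ.IsSymm
  isOpen : IsOpen V
  smooth : ∀ n, ContDiffOn ℝ ∞ (ψ n) V
  comm : CommutingHessians V η ψ
  gauss : GaussEquations V μ ψ

variable {V : Set (Coord N)} {η : Matrix (Fin N) (Fin N) ℝ}
  {μ : Matrix (Fin L) (Fin L) ℝ} {ψ : Fin L → Coord N → ℝ}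

theorem Setting.mul_inv (S : Setting V η μ ψ) : η * η⁻¹ = 1 :=
  Matrix.mul_nonsing_inv _ (isUnit_iff_ne_zero.2 S.det_η)

theorem Setting.inv_mul (S : Setting V η μ ψ) : η⁻¹ * η = 1 :=
  Matrix.nonsing_inv_mul _ (isUnit_iff_ne_zero.2 S.det_η)

theorem Setting.swap (S : Setting V η μ ψ) {u : Coord N} (hu : u ∈ V) (a b c d : Coord N) :
    contract μ (fun m => form (hess (ψ m) u) a b) (fun n => form (hess (ψ n) u) c d) =
      contract μ (fun m => form (hess (ψ m) u) a c) (fun n => form (hess (ψ n) u) b d) :=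
  contract_form_swap (S.gauss u hu) a b c d

theorem Setting.hess_symm (S : Setting V η μ ψ) {u : Coord N} (hu : u ∈ V) (n : Fin L) :
    (hess (ψ n) u).IsSymm := hess_isSymm S.isOpen (S.smooth n) hu

theorem Setting.form_comm (S : Setting V η μ ψ) {u : Coord N} (hu : u ∈ V) (n : Fin L)
    (a b : Coord N) : form (hess (ψ n) u) a b = form (hess (ψ n) u) b a :=
  HydroHierarchy.form_comm (S.hess_symm hu n) a b

theorem contDiffOn_mulVec_grad (hV : IsOpen V) {h : Coord N → ℝ} (hh : ContDiffOn ℝ ∞ h V)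
    (A : Matrix (Fin N) (Fin N) ℝ) (j : Fin N) :
    ContDiffOn ℝ ∞ (fun v => (A *ᵥ grad h v) j) V :=
  ContDiffOn.sum (s := Finset.univ) (f := fun r v => A j r * pd r h v) fun r _ =>
    contDiffOn_const.mul (contDiffOn_pd hV hh r)

theorem pd_mulVec_grad (hV : IsOpen V) {h : Coord N → ℝ} (hh : ContDiffOn ℝ ∞ h V)
    (A : Matrix (Fin N) (Fin N) ℝ) {u : Coord N} (hu : u ∈ V) (j q : Fin N) :
    pd q (fun v => (A *ᵥ grad h v) j) u = (A * hess h u) j q := by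
  have hd := fun r => differentiableAt_of_contDiffOn hV (contDiffOn_pd hV hh r) hu
  simp only [mulVec, dotProduct, grad]
  rw [pd_sum fun r => (hd r).const_mul _]
  refine Finset.sum_congr rfl fun r _ => ?_
  rw [pd_const_mul (hd r)]
  exact congrArg _ (pd2_symm hV hh hu q r)

theorem SolvesF.grad_eq (S : Setting V η μ ψ) {h : Coord N → ℝ} {F : Fin L → Coord N → ℝ}
    (hF : SolvesF V η ψ h F) {u : Coord N} (hu : u ∈ V) (n : Fin L) :
    grad (F n) u = hess (ψ n) u *ᵥ (η *ᵥ grad h u) := by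
  ext p
  rw [grad, ← hF.2 u hu n p]
  simp only [mulVec, dotProduct, Finset.mul_sum]
  refine Finset.sum_congr rfl fun j _ => Finset.sum_congr rfl fun r _ => ?_
  rw [pd2_symm S.isOpen (S.smooth n) hu, hess, grad]; ring

/-- The first relation of the recursion is solvable. -/
theorem Admissible.exists_solvesF (S : Setting V η μ ψ) (hc : Convex ℝ V) {h : Coord N → ℝ}
    (hh : Admissible V η ψ h) : ∃ F, SolvesF V η ψ h F := by
  have hV := S.isOpen
  have key : ∀ n, ∃ Q : Coord N → ℝ, ContDiffOn ℝ ∞ Q V ∧ ∀ u ∈ V, ∀ p,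
      pd p Q u = ∑ j, (η *ᵥ grad h u) j * pd p (pd j (ψ n)) u := by
    intro n
    refine exists_primitive_sum_mul_pd hV hc (fun j => contDiffOn_mulVec_grad hV hh.1 η j)
      (fun j => contDiffOn_pd hV (S.smooth n) j) ?_
    have e : ∀ u ∈ V, ∀ p q, ∑ j, pd q (fun v => (η *ᵥ grad h v) j) u * pd p (pd j (ψ n)) u =
        (hess (ψ n) u * η * hess h u) p q := by
      intro u hu p q
      rw [Matrix.mul_assoc, Matrix.mul_apply]
      exact Finset.sum_congr rfl fun j _ => by
        rw [pd_mulVec_grad hV hh.1 η hu, _root_.mul_comm]; rfl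
    intro u hu p q
    rw [e u hu, e u hu]
    -- Transposition reverses a product of symmetric matrices, so commuting through `η` amounts to
    -- symmetry of the product.
    have : (hess (ψ n) u * η * hess h u)ᵀ = hess (ψ n) u * η * hess h u := by
      rw [transpose_mul, transpose_mul, (hess_isSymm hV hh.1 hu).eq, (S.hess_symm hu n).eq,
        S.symm_η.eq, hh.2 u hu, Matrix.mul_assoc]
    rw [← this, transpose_apply, this]
  choose Q hQ hQ' using key
  refine ⟨Q, hQ, fun u hu n p => ?_⟩
  rw [hQ' n u hu]
  simp only [mulVec, dotProduct, Finset.sum_mul]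
  refine Finset.sum_congr rfl fun j _ => Finset.sum_congr rfl fun r _ => ?_
  rw [pd2_symm hV (S.smooth n) hu, pd2, grad]; ring

theorem contDiffOn_mulVec {F : Fin L → Coord N → ℝ} (hF : ∀ n, ContDiffOn ℝ ∞ (F n) V)
    (μ : Matrix (Fin L) (Fin L) ℝ) (m : Fin L) :
    ContDiffOn ℝ ∞ (fun v => (μ *ᵥ fun n => F n v) m) V :=
  ContDiffOn.sum (s := Finset.univ) (f := fun n v => μ m n * F n v) fun n _ =>
    contDiffOn_const.mul (hF n)

theorem pd_mulVec (hV : IsOpen V) {F : Fin L → Coord N → ℝ} (hF : ∀ n, ContDiffOn ℝ ∞ (F n) V)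
    (μ : Matrix (Fin L) (Fin L) ℝ) {u : Coord N} (hu : u ∈ V) (m : Fin L) (q : Fin N) :
    pd q (fun v => (μ *ᵥ fun n => F n v) m) u = (μ *ᵥ fun n => pd q (F n) u) m := by
  have hd := fun n => differentiableAt_of_contDiffOn hV (hF n) hu
  simp only [mulVec, dotProduct]
  rw [pd_sum fun n => (hd n).const_mul _]
  exact Finset.sum_congr rfl fun n _ => pd_const_mul (hd n) _ q

theorem sum_mulVec_mul (μ : Matrix (Fin L) (Fin L) ℝ) (x y : Fin L → ℝ) :
    ∑ m, (μ *ᵥ y) m * x m = contract μ x y := by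
  simp only [mulVec, dotProduct, contract, Finset.sum_mul]
  exact Finset.sum_congr rfl fun m _ => Finset.sum_congr rfl fun n _ => by ring

/-- The second relation of the recursion is solvable. -/
theorem SolvesF.exists_solvesH (S : Setting V η μ ψ) (hc : Convex ℝ V) {h : Coord N → ℝ}
    {F : Fin L → Coord N → ℝ} (hF : SolvesF V η ψ h F) : ∃ h', SolvesH V μ ψ F h' := by
  have hV := S.isOpen
  have key : ∀ k, ∃ Q : Coord N → ℝ, ContDiffOn ℝ ∞ Q V ∧ ∀ u ∈ V, ∀ p,
      pd p Q u = ∑ m, (μ *ᵥ fun n => F n u) m * pd p (pd k (ψ m)) u := by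
    intro k
    refine exists_primitive_sum_mul_pd hV hc (fun m => contDiffOn_mulVec hF.1 μ m)
      (fun m => contDiffOn_pd hV (S.smooth m) k) ?_
    -- Since `∂_q F_n = Ψ_n(e_q, η∇h)`, exchanging `p` and `q` is exactly the exchange of the middle
    -- slots in the Gauss equations.
    have e : ∀ u ∈ V, ∀ p q,
        ∑ m, pd q (fun v => (μ *ᵥ fun n => F n v) m) u * pd p (pd k (ψ m)) u =
        contract μ (fun m => form (hess (ψ m) u) (Pi.single k 1) (Pi.single p 1))
          (fun n => form (hess (ψ n) u) (Pi.single q 1) (η *ᵥ grad h u)) := by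
      intro u hu p q
      simp only [pd_mulVec hV hF.1 μ hu, sum_mulVec_mul, form_single_left (hess (ψ _) u) q,
        ← hF.grad_eq S hu]
      congr 1
      ext m
      rw [form_single_single]
      exact pd2_symm hV (S.smooth m) hu _ _
    intro u hu p q
    rw [e u hu, e u hu, S.swap hu]
  choose θ hθ hθ' using key
  -- Second integration: `∂_p θ_k` is symmetric in `p` and `k`, so the `θ_k` form a gradient.
  obtain ⟨Q, hQ, hQ'⟩ := exists_primitive hV hc hθ (fun u hu p q => by
    rw [hθ' p u hu, hθ' q u hu]
    exact Finset.sum_congr rfl fun m _ => congrArg _ (pd2_symm hV (S.smooth m) hu _ _))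
  refine ⟨Q, hQ, fun u hu j k => ?_⟩
  rw [pd2, pd_congr hV (fun v hv => hQ' v hv k) hu, hθ' k u hu, sum_mulVec_mul]
  exact Finset.sum_congr rfl fun m _ => Finset.sum_congr rfl fun n _ => rfl

theorem SolvesH.hess_eq {F : Fin L → Coord N → ℝ} {h' : Coord N → ℝ}
    (hh : SolvesH V μ ψ F h') {u : Coord N} (hu : u ∈ V) :
    hess h' u = ∑ m, ∑ n, (μ m n * F n u) • hess (ψ m) u := by
  ext j k
  rw [hess, ← hh.2 u hu]
  simp only [Matrix.sum_apply, Matrix.smul_apply, smul_eq_mul, hess]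
  exact Finset.sum_congr rfl fun m _ => Finset.sum_congr rfl fun n _ => by ring

/-- At each point `Hess h'` is a linear combination of the `Ψ_m`, so it inherits whatever they
commute with. Taking `A = Ψ_n` propagates admissibility; taking `A = Hess h_r` makes the hierarchy
commute. -/
theorem SolvesH.mul_comm {F : Fin L → Coord N → ℝ} {h' : Coord N → ℝ}
    (hh : SolvesH V μ ψ F h') {u : Coord N} (hu : u ∈ V) {A : Matrix (Fin N) (Fin N) ℝ}
    (hA : ∀ n, hess (ψ n) u * η * A = A * η * hess (ψ n) u) :
    hess h' u * η * A = A * η * hess h' u := by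
  rw [hh.hess_eq hu]
  simp only [Finset.sum_mul, Finset.mul_sum, smul_mul_assoc, Matrix.mul_smul, hA]

theorem SolvesH.admissible (S : Setting V η μ ψ) {F : Fin L → Coord N → ℝ} {h' : Coord N → ℝ}
    (hh : SolvesH V μ ψ F h') : Admissible V η ψ h' :=
  ⟨hh.1, fun _ hu n => (hh.mul_comm hu fun m => S.comm.mul_comm hu m n).symm⟩

/-- The density `½ η_{ij} u^i u^j`. -/
noncomputable def quadDensity (η : Matrix (Fin N) (Fin N) ℝ) : Coord N → ℝ :=
  fun u => (1 / 2) * ∑ i, ∑ j, η⁻¹ i j * u i * u j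

theorem contDiff_quadDensity (η : Matrix (Fin N) (Fin N) ℝ) : ContDiff ℝ ∞ (quadDensity η) :=
  contDiff_const.mul <| ContDiff.sum fun i _ => ContDiff.sum fun j _ =>
    (contDiff_const.mul (contDiff_apply ℝ ℝ i)).mul (contDiff_apply ℝ ℝ j)

theorem pd_quadDensity (hη : η.IsSymm) (q : Fin N) (u : Coord N) :
    pd q (quadDensity η) u = (η⁻¹ *ᵥ u) q := by
  have hd : ∀ i, DifferentiableAt ℝ (fun v : Coord N => v i) u := fun i => by fun_prop
  have h1 : ∀ i j, DifferentiableAt ℝ (fun v : Coord N => η⁻¹ i j * v i * v j) u :=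
    fun i j => by fun_prop
  have h2 : ∀ i, DifferentiableAt ℝ (fun v : Coord N => ∑ j, η⁻¹ i j * v i * v j) u :=
    fun i => by fun_prop
  have h3 : DifferentiableAt ℝ (fun v : Coord N => ∑ i, ∑ j, η⁻¹ i j * v i * v j) u := by fun_prop
  have hi : (η⁻¹).IsSymm := by rw [Matrix.IsSymm, transpose_nonsing_inv, hη.eq]
  unfold quadDensity
  rw [pd_const_mul h3, pd_sum h2]
  simp only [pd_sum (h1 _), pd_mul (((hd _).const_mul _)) (hd _), pd_const_mul (hd _), pd_coord,
    Finset.sum_add_distrib, Matrix.one_apply]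
  simp only [mul_ite, ite_mul, mul_one, mul_zero, zero_mul, Finset.sum_ite_eq',
    Finset.mem_univ, if_true, Finset.sum_ite_irrel, Finset.sum_const_zero]
  have : ∀ i, η⁻¹ i q = η⁻¹ q i := fun i => hi.apply _ _
  simp only [this, mulVec, dotProduct]
  ring

theorem hess_quadDensity (hη : η.IsSymm) (u : Coord N) : hess (quadDensity η) u = η⁻¹ := by
  ext p q
  have hi : (η⁻¹).IsSymm := by rw [Matrix.IsSymm, transpose_nonsing_inv, hη.eq]
  have hd : ∀ i, DifferentiableAt ℝ (fun v : Coord N => v i) u := fun i => by fun_prop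
  rw [hess, pd2, show pd q (quadDensity η) = fun u => (η⁻¹ *ᵥ u) q from
    funext fun u => pd_quadDensity hη q u]
  simp only [mulVec, dotProduct]
  rw [pd_sum fun j => (hd j).const_mul _]
  simp only [pd_const_mul (hd _), pd_coord, Matrix.one_apply]
  simp [hi.apply]

theorem Admissible.congr (hV : IsOpen V) {h g : Coord N → ℝ} (hh : Admissible V η ψ h)
    (e : ∀ u ∈ V, g u = h u) : Admissible V η ψ g := by
  refine ⟨hh.1.congr e, fun u hu n => ?_⟩
  have : hess g u = hess h u := by ext i j; exact pd2_congr hV e hu i j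
  rw [this, hh.2 u hu]

theorem admissible_quadDensity (S : Setting V η μ ψ) : Admissible V η ψ (quadDensity η) := by
  refine ⟨(contDiff_quadDensity η).contDiffOn, fun u _ n => ?_⟩
  rw [hess_quadDensity S.symm_η, Matrix.mul_assoc, S.mul_inv, S.inv_mul, Matrix.mul_one,
    Matrix.one_mul]

theorem SolvesUpTo.admissible (S : Setting V η μ ψ) {K : ℕ} {F : ℕ → Fin L → Coord N → ℝ}
    {h : ℕ → Coord N → ℝ} (hs : SolvesUpTo V η μ ψ K F h) {s : ℕ} (hsK : s ≤ K) :
    Admissible V η ψ (h (s + 1)) := by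
  rcases Nat.eq_zero_or_pos s with rfl | h1
  · exact (admissible_quadDensity S).congr S.isOpen hs.1
  · exact (hs.2 s h1 hsK).2.admissible S

/-- The recursion has solutions defined for all `s ≥ 1`. -/
theorem exists_solvesRecursion (S : Setting V η μ ψ) (hc : Convex ℝ V) :
    ∃ F h, SolvesRecursion V η μ ψ F h := by
  -- Carrying admissibility in a subtype lets the choices be iterated.
  have step : ∀ h : {h // Admissible V η ψ h}, ∃ (F : Fin L → Coord N → ℝ)
      (h' : {h // Admissible V η ψ h}), SolvesF V η ψ h F ∧ SolvesH V μ ψ F h' := by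
    rintro ⟨h, hh⟩
    obtain ⟨F, hF⟩ := hh.exists_solvesF S hc
    obtain ⟨h', hh'⟩ := hF.exists_solvesH S hc
    exact ⟨F, ⟨h', hh'.admissible S⟩, hF, hh'⟩
  choose F H hF hH using step
  let g : ℕ → {h // Admissible V η ψ h} :=
    fun s => Nat.rec ⟨quadDensity η, admissible_quadDensity S⟩ (fun _ h => H h) s
  -- `g t` is `h_{t+1}`; the truncated subtraction gives index `0` an irrelevant value.
  refine ⟨fun s => F (g (s - 1)), fun s => (g (s - 1)).1, fun K => ⟨fun u _ => rfl, ?_⟩⟩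
  intro s h1 _
  obtain ⟨t, rfl⟩ := Nat.exists_eq_add_of_le' h1
  exact ⟨hF (g t), hH (g t)⟩

end

/-! ### Local expressions, the recursion operator, commuting flows and involution. -/

section

variable {N L : ℕ}

open Matrix Filter Topology

variable {V : Set (Coord N)} {η : Matrix (Fin N) (Fin N) ℝ}
  {μ : Matrix (Fin L) (Fin L) ℝ} {ψ : Fin L → Coord N → ℝ}

theorem IsField.hasDerivAt {u : ℝ → Coord N} (hu : IsField V u) (x : ℝ) :
    HasDerivAt u (deriv u x) x :=
  (hu.1.differentiable (by simp) x).hasDerivAt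

section Local

variable {W : Type} [NormedAddCommGroup W] [NormedSpace ℝ W]

theorem isLocal_comp {f : Coord N → W} (hf : ContDiffOn ℝ ∞ f V) :
    IsLocal V (fun u x => f (u x)) := by
  refine ⟨0, fun J => f (J 0), hf.comp (contDiff_apply ℝ (Coord N) 0).contDiffOn fun J hJ => hJ, ?_⟩
  intro u _ x
  simp

theorem IsLocal.congr_germ {P : FieldFun N W} (hP : IsLocal V P) {u v : ℝ → Coord N}
    (hu : IsField V u) (hv : IsField V v) {x : ℝ} (h : u =ᶠ[𝓝 x] v) : P u x = P v x := by
  obtain ⟨k, f, -, hf⟩ := hP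
  rw [hf u hu, hf v hv]
  congr 1
  ext1 a
  exact h.iteratedDeriv_eq a

/-- Used to show that an integration constant is the same for all fields: by convexity two fields
can be joined inside `V` by one having the germs of both. -/
theorem exists_field_interpolating (hc : Convex ℝ V) {u v : ℝ → Coord N}
    (hu : IsField V u) (hv : IsField V v) :
    ∃ w, IsField V w ∧ w =ᶠ[𝓝 0] u ∧ w =ᶠ[𝓝 1] v := by
  -- The cutoff is `0` for `x ≤ 1/3` and `1` for `x ≥ 2/3`, hence constant near both endpoints.
  let χ : ℝ → ℝ := fun x => Real.smoothTransition (3 * x - 1)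
  have hχ : ContDiff ℝ ∞ χ := Real.smoothTransition.contDiff.comp (by fun_prop)
  refine ⟨fun x => (1 - χ x) • u x + χ x • v x, ⟨?_, fun x => ?_⟩, ?_, ?_⟩
  · exact ((contDiff_const.sub hχ).smul hu.1).add (hχ.smul hv.1)
  · exact hc (hu.2 x) (hv.2 x) (sub_nonneg.2 (Real.smoothTransition.le_one _))
      (Real.smoothTransition.nonneg _) (by ring)
  · filter_upwards [Iio_mem_nhds (show (0 : ℝ) < 1 / 3 by norm_num)] with x hx
    have : χ x = 0 := Real.smoothTransition.zero_of_nonpos (by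
      have : x < 1 / 3 := hx
      linarith)
    simp [this]
  · filter_upwards [Ioi_mem_nhds (show (2 / 3 : ℝ) < 1 by norm_num)] with x hx
    have : χ x = 1 := Real.smoothTransition.one_of_one_le (by
      have : 2 / 3 < x := hx
      linarith)
    simp [this]

/-- Two local antiderivatives of the same expression differ by a constant. -/
theorem IsLocal.eq_add_const (hc : Convex ℝ V) {P Q R : FieldFun N W}
    (hP : IsLocal V P) (hQ : IsLocal V Q) (hPR : IsTotalDeriv V P R) (hQR : IsTotalDeriv V Q R) :
    ∃ c, ∀ u, IsField V u → ∀ x, P u x = Q u x + c := by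
  have hconst : ∀ u, IsField V u → ∀ x y, P u x - Q u x = P u y - Q u y := by
    intro u hu
    refine is_const_of_deriv_eq_zero (f := fun x => P u x - Q u x)
      (fun x => ((hPR u hu x).sub (hQR u hu x)).differentiableAt) fun x => ?_
    exact ((hPR u hu x).sub (hQR u hu x)).deriv.trans (sub_self _)
  by_cases hne : ∃ u, IsField V u
  · obtain ⟨u₀, hu₀⟩ := hne
    refine ⟨P u₀ 0 - Q u₀ 0, fun u hu x => ?_⟩
    -- The difference `P - Q` is constant along `w`. It takes the value of `u₀` at `0` and the value
    -- of `u` at `1`, because local expressions see only germs.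
    obtain ⟨w, hw, hw0, hw1⟩ := exists_field_interpolating hc hu₀ hu
    rw [← hP.congr_germ hw hu₀ hw0, ← hQ.congr_germ hw hu₀ hw0, hconst w hw 0 1,
      hP.congr_germ hw hu hw1, hQ.congr_germ hw hu hw1, hconst u hu 1 x]
    abel
  · exact ⟨0, fun u hu => (hne ⟨u, hu⟩).elim⟩

end Local

theorem rightFactor_eq (hη : η.IsSymm) (u ξ : ℝ → Coord N) (n : Fin L) (x : ℝ) :
    rightFactor η ψ u ξ n x = form (hess (ψ n) (u x)) (η *ᵥ ξ x) (deriv u x) := by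
  rw [form_eq_sum]
  simp only [rightFactor, mulVec, dotProduct, Finset.mul_sum, Finset.sum_mul, hess]
  rw [Finset.sum_comm]
  refine Finset.sum_congr rfl fun r _ => ?_
  rw [Finset.sum_comm]
  refine Finset.sum_congr rfl fun s _ => Finset.sum_congr rfl fun j _ => ?_
  rw [hη.apply]; ring

theorem leftFactor_eq (u : ℝ → Coord N) (P : Fin L → ℝ → ℝ) (x : ℝ) :
    leftFactor η μ ψ u P x =
      η *ᵥ ((∑ m, ∑ n, (μ m n * P n x) • hess (ψ m) (u x)) *ᵥ deriv u x) := by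
  ext i
  simp only [leftFactor, sum_mulVec, smul_mulVec, mulVec_sum, mulVec_smul, Finset.sum_apply,
    Pi.smul_apply, smul_eq_mul]
  refine Finset.sum_congr rfl fun m _ => Finset.sum_congr rfl fun n _ => ?_
  simp only [mulVec, dotProduct, Finset.mul_sum, hess]
  exact Finset.sum_congr rfl fun p _ => Finset.sum_congr rfl fun k _ => by ring

theorem dotProduct_mulVec_symm (hη : η.IsSymm) (a b : Coord N) :
    a ⬝ᵥ (η *ᵥ b) = (η *ᵥ a) ⬝ᵥ b := by
  rw [dotProduct_mulVec, ← mulVec_transpose, hη.eq]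

theorem dotProduct_leftFactor (hη : η.IsSymm) (u : ℝ → Coord N) (P : Fin L → ℝ → ℝ)
    (x : ℝ) (a : Coord N) :
    a ⬝ᵥ leftFactor η μ ψ u P x =
      contract μ (fun m => form (hess (ψ m) (u x)) (η *ᵥ a) (deriv u x)) (fun n => P n x) := by
  rw [leftFactor_eq, dotProduct_mulVec_symm hη]
  simp only [sum_mulVec, smul_mulVec, dotProduct_sum, dotProduct_smul, contract, form, smul_eq_mul]
  exact Finset.sum_congr rfl fun m _ => Finset.sum_congr rfl fun n _ => by ring

theorem flow_eq_leftFactor (F : Fin L → Coord N → ℝ) (u : ℝ → Coord N) (x : ℝ) :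
    flow η μ ψ F u x = leftFactor η μ ψ u (fun n y => F n (u y)) x := by
  ext i
  simp only [flow, leftFactor]
  exact Finset.sum_congr rfl fun m _ => Finset.sum_congr rfl fun n _ =>
    Finset.sum_congr rfl fun p _ => Finset.sum_congr rfl fun k _ => by ring

theorem flow_eq {F : Fin L → Coord N → ℝ} {h' : Coord N → ℝ} (hh : SolvesH V μ ψ F h')
    {u : ℝ → Coord N} {x : ℝ} (hx : u x ∈ V) :
    flow η μ ψ F u x = η *ᵥ (hess h' (u x) *ᵥ deriv u x) := by
  rw [flow_eq_leftFactor, leftFactor_eq, hh.hess_eq hx]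

theorem isHydrodynamic_of_density (hV : IsOpen V) {h : Coord N → ℝ} (hh : ContDiffOn ℝ ∞ h V)
    {Y : FieldFun N (Coord N)}
    (hY : ∀ u, IsField V u → ∀ x, Y u x = η *ᵥ (hess h (u x) *ᵥ deriv u x)) :
    IsHydrodynamic V Y := by
  refine ⟨fun i k v => ∑ p, η i p * pd2 p k h v, fun i k =>
    ContDiffOn.sum fun p _ => contDiffOn_const.mul (contDiffOn_pd2 hV hh p k), ?_⟩
  intro u hu x i
  rw [hY u hu, mulVec_mulVec]
  rfl

/-- The derivative of `hess f (γ t) *ᵥ β t`, where `v`, `b` are the derivatives of `γ`, `β`. -/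
noncomputable def hessVar (f : Coord N → ℝ) (w v a b : Coord N) : Coord N :=
  fun j => ∑ k, ((∑ l, pd l (pd2 j k f) w * v l) * a k + pd2 j k f w * b k)

theorem hasDerivAt_hess_mulVec (hV : IsOpen V) {f : Coord N → ℝ} (hf : ContDiffOn ℝ ∞ f V)
    {γ β : ℝ → Coord N} {γ' β' : Coord N} {t : ℝ} (ht : γ t ∈ V) (hγ : HasDerivAt γ γ' t)
    (hβ : HasDerivAt β β' t) :
    HasDerivAt (fun s => hess f (γ s) *ᵥ β s) (hessVar f (γ t) γ' (β t) β') t := by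
  rw [hasDerivAt_pi]
  intro j
  have hd := fun k => differentiableAt_of_contDiffOn hV (contDiffOn_pd2 hV hf j k) ht
  exact HasDerivAt.fun_sum (u := Finset.univ) (A := fun k s => pd2 j k f (γ s) * β s k) fun k _ =>
    (hasDerivAt_comp_curve (hd k) hγ).mul (hasDerivAt_pi.1 hβ k)

theorem pd_pd2_symm (hV : IsOpen V) {f : Coord N → ℝ} (hf : ContDiffOn ℝ ∞ f V)
    {w : Coord N} (hw : w ∈ V) (j k l : Fin N) :
    pd l (pd2 j k f) w = pd k (pd2 j l f) w := by
  have h1 := fun i => contDiffOn_pd hV hf i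
  change pd2 l j (pd k f) w = pd2 k j (pd l f) w
  rw [pd2_symm hV (h1 k) hw l j, pd2_symm hV (h1 l) hw k j]
  exact pd_congr hV (fun v hv => pd2_symm hV hf hv l k) hw j

/-- Total symmetry of third derivatives. With `a = u_x` and `b = v_x` it identifies the variation of
`Hess f(u) u_x` along `v` with the `x`-derivative of `Hess f(u) v`. -/
theorem hessVar_symm (hV : IsOpen V) {f : Coord N → ℝ} (hf : ContDiffOn ℝ ∞ f V)
    {w : Coord N} (hw : w ∈ V) (v a b : Coord N) : hessVar f w v a b = hessVar f w a v b := by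
  ext j
  simp only [hessVar, Finset.sum_add_distrib, Finset.sum_mul]
  rw [Finset.sum_comm]
  congr 1
  refine Finset.sum_congr rfl fun l _ => Finset.sum_congr rfl fun k _ => ?_
  rw [pd_pd2_symm hV hf hw]; ring

theorem hasDerivAt_grad (hV : IsOpen V) {h : Coord N → ℝ} (hh : ContDiffOn ℝ ∞ h V)
    {γ : ℝ → Coord N} {γ' : Coord N} {t : ℝ} (ht : γ t ∈ V) (hγ : HasDerivAt γ γ' t) :
    HasDerivAt (fun y => grad h (γ y)) (hess h (γ t) *ᵥ γ') t := by
  rw [hasDerivAt_pi]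
  intro j
  refine (hasDerivAt_comp_curve (differentiableAt_of_contDiffOn hV (contDiffOn_pd hV hh j) ht)
    hγ).congr_deriv ?_
  exact Finset.sum_congr rfl fun i _ => congrArg (· * γ' i) (pd2_symm hV hh ht i j)

theorem HasDerivAt.mulVec_const {M : ℕ} {g : ℝ → Coord N} {g' : Coord N} {x : ℝ}
    (hg : HasDerivAt g g' x) (A : Matrix (Fin M) (Fin N) ℝ) :
    HasDerivAt (fun y => A *ᵥ g y) (A *ᵥ g') x :=
  hasDerivAt_pi.2 fun i => HasDerivAt.fun_sum (u := Finset.univ)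
    (A := fun j y => A i j * g y j) fun j _ => (hasDerivAt_pi.1 hg j).const_mul _

theorem isLocal_varDeriv (hV : IsOpen V) {h : Coord N → ℝ} (hh : ContDiffOn ℝ ∞ h V) :
    IsLocal V (varDeriv h) :=
  isLocal_comp (f := grad h) (contDiffOn_pi.2 fun i => contDiffOn_pd hV hh i)

theorem isM2Value_varDeriv (hV : IsOpen V) {h : Coord N → ℝ} (hh : ContDiffOn ℝ ∞ h V)
    {Y : FieldFun N (Coord N)}
    (hY : ∀ u, IsField V u → ∀ x, Y u x = η *ᵥ (hess h (u x) *ᵥ deriv u x)) :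
    IsM2Value V η (varDeriv h) Y := by
  intro u hu x
  rw [hY u hu]
  exact HasDerivAt.mulVec_const (hasDerivAt_grad hV hh (hu.2 x) (hu.hasDerivAt x)) η

theorem SolvesF.form_eq (S : Setting V η μ ψ) {h : Coord N → ℝ} {F : Fin L → Coord N → ℝ}
    (hF : SolvesF V η ψ h F) {u : Coord N} (hu : u ∈ V) (n : Fin L) (a : Coord N) :
    form (hess (ψ n) u) (η *ᵥ grad h u) a = ∑ k, pd k (F n) u * a k := by
  rw [S.form_comm hu, form, ← hF.grad_eq S hu, dotProduct_comm]
  rfl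

theorem SolvesF.isInvDx (S : Setting V η μ ψ) {h : Coord N → ℝ} {F : Fin L → Coord N → ℝ}
    (hF : SolvesF V η ψ h F) {G : FieldFun N (Coord N)}
    (hG : ∀ u, IsField V u → ∀ x, G u x = grad h (u x)) (n : Fin L) :
    IsInvDx V (fun u x => rightFactor η ψ u (G u) n x) (fun u x => F n (u x)) := by
  refine ⟨isLocal_comp (hF.1 n), fun u hu x => ?_⟩
  beta_reduce
  rw [rightFactor_eq S.symm_η, hG u hu, hF.form_eq S (hu.2 x)]
  exact hasDerivAt_comp_curve (differentiableAt_of_contDiffOn S.isOpen (hF.1 n) (hu.2 x))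
    (hu.hasDerivAt x)

theorem SolvesF.isM1Value (S : Setting V η μ ψ) {h : Coord N → ℝ} {F : Fin L → Coord N → ℝ}
    (hF : SolvesF V η ψ h F) {G : FieldFun N (Coord N)}
    (hG : ∀ u, IsField V u → ∀ x, G u x = grad h (u x)) :
    IsM1Value V η μ ψ G (flow η μ ψ F) :=
  ⟨fun n u x => F n (u x), hF.isInvDx S hG, fun u _ x => flow_eq_leftFactor F u x⟩

theorem SolvesF.add_const (hV : IsOpen V) {h : Coord N → ℝ} {F : Fin L → Coord N → ℝ}
    (hF : SolvesF V η ψ h F) (c : Fin L → ℝ) : SolvesF V η ψ h (fun n v => F n v + c n) := by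
  refine ⟨fun n => (hF.1 n).add contDiffOn_const, fun u hu n p => ?_⟩
  rw [pd_add (differentiableAt_of_contDiffOn hV (hF.1 n) hu) (differentiableAt_const _), pd_const,
    add_zero, hF.2 u hu]

/-- The integration constants in `M₁` are absorbed into the functions `F_n`, which the first
relation determines only up to constants. -/
theorem IsM1Value.exists_solvesF (S : Setting V η μ ψ) (hc : Convex ℝ V) {h : Coord N → ℝ}
    {F : Fin L → Coord N → ℝ} (hF : SolvesF V η ψ h F) {G Y : FieldFun N (Coord N)}
    (hG : ∀ u, IsField V u → ∀ x, G u x = grad h (u x)) (hY : IsM1Value V η μ ψ G Y) :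
    ∃ F', SolvesF V η ψ h F' ∧ ∀ u, IsField V u → ∀ x, Y u x = flow η μ ψ F' u x := by
  obtain ⟨P, hP, hY⟩ := hY
  have key : ∀ n, ∃ c, ∀ u, IsField V u → ∀ x, P n u x = F n (u x) + c := fun n =>
    (hP n).1.eq_add_const hc (isLocal_comp (hF.1 n)) (hP n).2 (hF.isInvDx S hG n).2
  choose c hc' using key
  refine ⟨_, hF.add_const S.isOpen c, fun u hu x => ?_⟩
  rw [hY u hu, flow_eq_leftFactor]
  congr 1
  ext n y
  exact hc' n u hu y

/-- Absorbs the integration constants of `M₂⁻¹`: a linear function shifts the gradient and leaves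
the Hessian, hence admissibility, unchanged. -/
theorem Admissible.add_linear (hV : IsOpen V) {h : Coord N → ℝ} (hh : Admissible V η ψ h)
    (c : Coord N) : ∃ g, Admissible V η ψ g ∧ (∀ u ∈ V, grad g u = grad h u + c) := by
  have hl : ∀ v, DifferentiableAt ℝ (fun v : Coord N => ∑ i, c i * v i) v := fun v => by fun_prop
  have hd : ∀ i (v : Coord N), DifferentiableAt ℝ (fun v : Coord N => v i) v :=
    fun i v => by fun_prop
  have e : ∀ u ∈ V, ∀ j, pd j (fun v => h v + ∑ i, c i * v i) u = pd j h u + c j := by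
    intro u hu j
    rw [pd_add (differentiableAt_of_contDiffOn hV hh.1 hu) (hl u), pd_sum fun i =>
      (hd i u).const_mul _]
    simp [pd_const_mul (hd _ u), pd_coord, Matrix.one_apply]
  refine ⟨fun v => h v + ∑ i, c i * v i, ⟨hh.1.add (by fun_prop), fun u hu n => ?_⟩,
    fun u hu => funext (e u hu)⟩
  have : hess (fun v => h v + ∑ i, c i * v i) u = hess h u := by
    ext i j
    rw [hess, pd2, pd_congr hV (fun v hv => e v hv j) hu, pd_add
      (differentiableAt_of_contDiffOn hV (contDiffOn_pd hV hh.1 j) hu) (differentiableAt_const _),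
      pd_const, add_zero]
    rfl
  rw [this, hh.2 u hu]

theorem mulVec_inv_cancel (S : Setting V η μ ψ) (a : Coord N) : η⁻¹ *ᵥ (η *ᵥ a) = a := by
  rw [mulVec_mulVec, S.inv_mul, one_mulVec]

/-- Applying the recursion operator to an expression `η (∇h)_x`. -/
theorem IsRValue.exists_density (S : Setting V η μ ψ) (hc : Convex ℝ V) {h : Coord N → ℝ}
    (hh : Admissible V η ψ h) {Y Y' : FieldFun N (Coord N)}
    (hY : ∀ u, IsField V u → ∀ x, Y u x = η *ᵥ (hess h (u x) *ᵥ deriv u x))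
    (hYY' : IsRValue V η μ ψ Y Y') :
    ∃ h', Admissible V η ψ h' ∧
      ∀ u, IsField V u → ∀ x, Y' u x = η *ᵥ (hess h' (u x) *ᵥ deriv u x) := by
  obtain ⟨G, hG, hG2, hG1⟩ := hYY'
  have hd : IsTotalDeriv V G (fun u x => hess h (u x) *ᵥ deriv u x) := by
    intro u hu x
    have := HasDerivAt.mulVec_const (hG2 u hu x) η⁻¹
    simpa only [hY u hu, mulVec_inv_cancel S] using this
  obtain ⟨c, hc'⟩ := hG.eq_add_const hc (isLocal_varDeriv S.isOpen hh.1) hd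
    (fun u hu x => hasDerivAt_grad S.isOpen hh.1 (hu.2 x) (hu.hasDerivAt x))
  obtain ⟨g, hg, hgrad⟩ := hh.add_linear S.isOpen c
  obtain ⟨F, hF⟩ := hg.exists_solvesF S hc
  obtain ⟨F', hF', hY'⟩ := hG1.exists_solvesF S hc hF fun u hu x => by
    rw [hc' u hu, hgrad _ (hu.2 x)]; rfl
  obtain ⟨h', hh'⟩ := hF'.exists_solvesH S hc
  exact ⟨h', hh'.admissible S, fun u hu x => by rw [hY' u hu, flow_eq hh' (hu.2 x)]⟩

theorem isRPowValue_exists_density (S : Setting V η μ ψ) (hc : Convex ℝ V) (s : ℕ) :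
    ∀ Y, IsRPowValue V η μ ψ s Y → ∃ h, Admissible V η ψ h ∧
      ∀ u, IsField V u → ∀ x, Y u x = η *ᵥ (hess h (u x) *ᵥ deriv u x) := by
  induction s with
  | zero =>
    intro Y hY
    refine ⟨_, admissible_quadDensity S, fun u hu x => ?_⟩
    rw [hY u hu, hess_quadDensity S.symm_η, mulVec_mulVec, S.mul_inv, one_mulVec]
  | succ s ih =>
    rintro Y ⟨Y', hY', hR⟩
    obtain ⟨h, hh, e⟩ := ih Y' hY'
    exact hR.exists_density S hc hh e

theorem isRValue_flow (S : Setting V η μ ψ) {h : Coord N → ℝ} (hh : ContDiffOn ℝ ∞ h V)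
    {Y : FieldFun N (Coord N)}
    (hY : ∀ u, IsField V u → ∀ x, Y u x = η *ᵥ (hess h (u x) *ᵥ deriv u x))
    {F : Fin L → Coord N → ℝ} (hF : SolvesF V η ψ h F) :
    IsRValue V η μ ψ Y (flow η μ ψ F) :=
  ⟨varDeriv h, isLocal_varDeriv S.isOpen hh, isM2Value_varDeriv S.isOpen hh hY,
    hF.isM1Value S fun _ _ _ => rfl⟩

theorem isRPowValue_exists_isRValue (S : Setting V η μ ψ) (hc : Convex ℝ V) {s : ℕ}
    {Y : FieldFun N (Coord N)} (hY : IsRPowValue V η μ ψ s Y) :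
    ∃ Y', IsRValue V η μ ψ Y Y' := by
  obtain ⟨h, hh, e⟩ := isRPowValue_exists_density S hc s Y hY
  obtain ⟨F, hF⟩ := hh.exists_solvesF S hc
  exact ⟨_, isRValue_flow S hh.1 e hF⟩

theorem exists_isRPowValue (S : Setting V η μ ψ) (hc : Convex ℝ V) (s : ℕ) :
    ∃ Y, IsRPowValue V η μ ψ s Y := by
  induction s with
  | zero => exact ⟨fun u x => deriv u x, fun _ _ _ => rfl⟩
  | succ s ih =>
    obtain ⟨Y, hY⟩ := ih
    obtain ⟨Y', hY'⟩ := isRPowValue_exists_isRValue S hc hY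
    exact ⟨Y', Y, hY, hY'⟩

section Recursion

variable {F : ℕ → Fin L → Coord N → ℝ} {h : ℕ → Coord N → ℝ}

theorem SolvesRecursion.solvesF (hs : SolvesRecursion V η μ ψ F h) {s : ℕ} (h1 : 1 ≤ s) :
    SolvesF V η ψ (h s) (F s) := ((hs s).2 s h1 le_rfl).1

theorem SolvesRecursion.solvesH (hs : SolvesRecursion V η μ ψ F h) {s : ℕ} (h1 : 1 ≤ s) :
    SolvesH V μ ψ (F s) (h (s + 1)) := ((hs s).2 s h1 le_rfl).2

theorem SolvesRecursion.admissible (S : Setting V η μ ψ) (hs : SolvesRecursion V η μ ψ F h)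
    {s : ℕ} (h1 : 1 ≤ s) : Admissible V η ψ (h s) := by
  obtain ⟨t, rfl⟩ := Nat.exists_eq_add_of_le' h1
  exact (hs t).admissible S le_rfl

theorem SolvesRecursion.isRPowValue (S : Setting V η μ ψ) (hs : SolvesRecursion V η μ ψ F h)
    {s : ℕ} (h1 : 1 ≤ s) : IsRPowValue V η μ ψ s (flow η μ ψ (F s)) := by
  induction s, h1 using Nat.le_induction with
  | base =>
    refine ⟨fun u x => deriv u x, fun _ _ _ => rfl, isRValue_flow S (hs.admissible S le_rfl).1 ?_
      (hs.solvesF le_rfl)⟩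
    intro u hu x
    have : hess (h 1) (u x) = η⁻¹ := by
      rw [← hess_quadDensity S.symm_η (u x)]
      ext i j
      exact pd2_congr S.isOpen (hs 1).1 (hu.2 x) i j
    rw [this, mulVec_mulVec, S.mul_inv, one_mulVec]
  | succ s h1 ih =>
    exact ⟨_, ih, isRValue_flow S (hs.solvesH h1).1 (fun u hu x => flow_eq (hs.solvesH h1) (hu.2 x))
      (hs.solvesF (by omega))⟩

/-- The first Hessian is `η⁻¹`, for which both products reduce to the other Hessian; each later one
is a combination of the `Ψ_m`, with which every `Hess h_r` commutes. -/
theorem SolvesRecursion.hess_mul_comm (S : Setting V η μ ψ) (hs : SolvesRecursion V η μ ψ F h)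
    {p r : ℕ} (hp : 1 ≤ p) (hr : 1 ≤ r) {u : Coord N} (hu : u ∈ V) :
    hess (h p) u * η * hess (h r) u = hess (h r) u * η * hess (h p) u := by
  rcases hp.eq_or_lt with rfl | hp
  · have : hess (h 1) u = η⁻¹ := by
      rw [← hess_quadDensity S.symm_η u]
      ext i j
      exact pd2_congr S.isOpen (hs 1).1 hu i j
    rw [this, S.inv_mul, Matrix.mul_assoc, S.mul_inv, Matrix.one_mul, Matrix.mul_one]
  · obtain ⟨q, rfl⟩ := Nat.exists_eq_add_of_le' hp.le
    exact (hs.solvesH (by omega)).mul_comm hu ((hs.admissible S hr).2 u hu)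

end Recursion

/-- The flow is `η (∇f)_x`, and variation commutes with `d/dx`, so varying along `v` gives `η (Hess
f · v)_x`. -/
theorem flow_hasDerivAt (hV : IsOpen V) {F : Fin L → Coord N → ℝ} {f : Coord N → ℝ}
    (hf : SolvesH V μ ψ F f) {u v : ℝ → Coord N} (hu : IsField V u) {x : ℝ} {v' : Coord N}
    (hv : HasDerivAt v v' x) :
    HasDerivAt (fun ε : ℝ => flow η μ ψ F (u + ε • v) x)
      (η *ᵥ deriv (fun y => hess f (u y) *ᵥ v y) x) 0 := by
  rw [(hasDerivAt_hess_mulVec hV hf.1 (hu.2 x) (hu.hasDerivAt x) hv).deriv,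
    ← hessVar_symm hV hf.1 (hu.2 x)]
  have hcont : Continuous fun ε : ℝ => u x + ε • v x := by fun_prop
  have hmem : ∀ᶠ ε in 𝓝 (0 : ℝ), u x + ε • v x ∈ V :=
    hcont.continuousAt.eventually_mem (hV.mem_nhds (by simpa using hu.2 x))
  have hlin : ∀ a b : Coord N, HasDerivAt (fun ε : ℝ => a + ε • b) b 0 := fun a b => by
    simpa using ((hasDerivAt_id (0 : ℝ)).smul_const b).const_add a
  have key := HasDerivAt.mulVec_const (hasDerivAt_hess_mulVec hV hf.1
    (by simpa using hu.2 x) (hlin (u x) (v x)) (hlin (deriv u x) v')) η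
  simp only [zero_smul, add_zero] at key
  refine key.congr_of_eventuallyEq ?_
  filter_upwards [hmem] with ε hε
  rw [flow_eq hf hε, ((hu.hasDerivAt x).add (hv.const_smul ε)).deriv]
  rfl

theorem flowsCommute (hV : IsOpen V) {F G : Fin L → Coord N → ℝ} {f g : Coord N → ℝ}
    (hf : SolvesH V μ ψ F f) (hg : SolvesH V μ ψ G g)
    (hcomm : ∀ u ∈ V, hess f u * η * hess g u = hess g u * η * hess f u) :
    FlowsCommute V (flow η μ ψ F) (flow η μ ψ G) := by
  intro u hu x
  have hu' : ∀ x, HasDerivAt (deriv u) (deriv (deriv u) x) x := fun x =>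
    ((contDiff_infty_iff_deriv.1 hu.1).2.differentiable (by simp) x).hasDerivAt
  have hflow : ∀ {F : Fin L → Coord N → ℝ} {f : Coord N → ℝ}, SolvesH V μ ψ F f →
      ∃ d, HasDerivAt (flow η μ ψ F u) d x := fun {F f} hf => by
    rw [show flow η μ ψ F u = fun x => η *ᵥ (hess f (u x) *ᵥ deriv u x) from
      funext fun y => flow_eq hf (hu.2 y)]
    exact ⟨_, HasDerivAt.mulVec_const
      (hasDerivAt_hess_mulVec hV hf.1 (hu.2 x) (hu.hasDerivAt x) (hu' x)) η⟩
  obtain ⟨df, hdf⟩ := hflow hf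
  obtain ⟨dg, hdg⟩ := hflow hg
  refine ⟨_, flow_hasDerivAt hV hf hu hdg, ?_⟩
  -- It remains to compare `Hess f η Hess g u_x` with `Hess g η Hess f u_x` under `d/dx`.
  convert flow_hasDerivAt hV hg hu hdf using 4 with y
  rw [flow_eq hf (hu.2 y), flow_eq hg (hu.2 y)]
  simp only [mulVec_mulVec, ← Matrix.mul_assoc, hcomm _ (hu.2 y)]

theorem isNullDensity_of_primitive (hV : IsOpen V) {Q : Coord N → ℝ} (hQ : ContDiffOn ℝ ∞ Q V)
    {q : FieldFun N ℝ} (h : ∀ u, IsField V u → ∀ x, q u x = ∑ k, pd k Q (u x) * deriv u x k) :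
    IsNullDensity V q := by
  refine ⟨fun u x => Q (u x), isLocal_comp hQ, fun u hu x => ?_⟩
  rw [h u hu]
  exact hasDerivAt_comp_curve (differentiableAt_of_contDiffOn hV hQ (hu.2 x)) (hu.hasDerivAt x)

/-- The integrand is the 1-form `μ^{mn} G'_n dF_m` evaluated on `u_x`. Its closedness is the Gauss
symmetry with `η∇h` and `η∇g` in the outer slots. -/
theorem inInvolution_M1 (S : Setting V η μ ψ) (hc : Convex ℝ V) {h g : Coord N → ℝ}
    {F G : Fin L → Coord N → ℝ} (hF : SolvesF V η ψ h F) (hG : SolvesF V η ψ g G) :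
    InInvolution V (IsM1Value V η μ ψ) h g := by
  refine ⟨⟨_, hG.isM1Value S fun _ _ _ => rfl⟩, fun Y hY => ?_⟩
  obtain ⟨G', hG', hY⟩ := hY.exists_solvesF S hc hG fun _ _ _ => rfl
  have hV := S.isOpen
  obtain ⟨Q, hQ, hQ'⟩ := exists_primitive_sum_mul_pd hV hc (contDiffOn_mulVec hG'.1 μ) hF.1 (by
    have e : ∀ u ∈ V, ∀ p q,
        ∑ m, pd q (fun v => (μ *ᵥ fun n => G' n v) m) u * pd p (F m) u =
        contract μ (fun m => form (hess (ψ m) u) (η *ᵥ grad h u) (Pi.single p 1))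
          (fun n => form (hess (ψ n) u) (Pi.single q 1) (η *ᵥ grad g u)) := by
      intro u hu p q
      simp only [pd_mulVec hV hG'.1 μ hu, sum_mulVec_mul, S.form_comm hu _ (η *ᵥ grad h u),
        form_single_left, ← hF.grad_eq S hu, ← hG'.grad_eq S hu]
      rfl
    intro u hu p q
    rw [e u hu, e u hu, S.swap hu])
  refine isNullDensity_of_primitive hV hQ fun u hu x => ?_
  have e1 : ∑ i, varDeriv h u x i * Y u x i = grad h (u x) ⬝ᵥ Y u x := rfl
  rw [e1, hY u hu, flow_eq_leftFactor, dotProduct_leftFactor S.symm_η]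
  simp only [hF.form_eq S (hu.2 x), hQ' _ (hu.2 x), Finset.sum_mul]
  rw [Finset.sum_comm, ← sum_mulVec_mul]
  refine Finset.sum_congr rfl fun m _ => ?_
  rw [Finset.mul_sum]
  exact Finset.sum_congr rfl fun k _ => by ring

/-- The integrand is the 1-form `(η∇h)_j d(∂_j g)` on `u_x`, closed because `Hess g η Hess h` is
symmetric. -/
theorem inInvolution_M2 (hV : IsOpen V) (hc : Convex ℝ V) (hη : η.IsSymm) {h g : Coord N → ℝ}
    (hh : ContDiffOn ℝ ∞ h V) (hg : ContDiffOn ℝ ∞ g V)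
    (hcomm : ∀ u ∈ V, hess h u * η * hess g u = hess g u * η * hess h u) :
    InInvolution V (IsM2Value V η) h g := by
  have hval : IsM2Value V η (varDeriv g) (fun u x => η *ᵥ (hess g (u x) *ᵥ deriv u x)) :=
    isM2Value_varDeriv hV hg fun _ _ _ => rfl
  refine ⟨⟨_, hval⟩, fun Y hY => ?_⟩
  obtain ⟨Q, hQ, hQ'⟩ := exists_primitive_sum_mul_pd hV hc (contDiffOn_mulVec_grad hV hh η)
    (contDiffOn_pd hV hg) (by
    have e : ∀ u ∈ V, ∀ p q, ∑ j, pd q (fun v => (η *ᵥ grad h v) j) u * pd p (pd j g) u =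
        (hess g u * η * hess h u) p q := by
      intro u hu p q
      rw [Matrix.mul_assoc, Matrix.mul_apply]
      exact Finset.sum_congr rfl fun j _ => by
        rw [pd_mulVec_grad hV hh η hu, _root_.mul_comm]; rfl
    intro u hu p q
    rw [e u hu, e u hu]
    have : (hess g u * η * hess h u)ᵀ = hess g u * η * hess h u := by
      rw [transpose_mul, transpose_mul, (hess_isSymm hV hh hu).eq, (hess_isSymm hV hg hu).eq,
        hη.eq, ← hcomm u hu, Matrix.mul_assoc]
    rw [← this, transpose_apply, this])
  refine isNullDensity_of_primitive hV hQ fun u hu x => ?_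
  have e1 : ∑ i, varDeriv h u x i * Y u x i = grad h (u x) ⬝ᵥ Y u x := rfl
  rw [e1, (hY u hu x).unique (hval u hu x), dotProduct_mulVec_symm hη]
  simp only [hQ' _ (hu.2 x), Finset.sum_mul]
  rw [Finset.sum_comm, dotProduct]
  refine Finset.sum_congr rfl fun j _ => ?_
  have e2 : (hess g (u x) *ᵥ deriv u x) j = ∑ k, pd2 k j g (u x) * deriv u x k := by
    change ∑ k, pd2 j k g (u x) * deriv u x k = _
    exact Finset.sum_congr rfl fun k _ => congrArg (· * deriv u x k) (pd2_symm hV hg (hu.2 x) j k)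
  rw [e2, Finset.mul_sum]
  exact Finset.sum_congr rfl fun k _ => (mul_assoc _ _ _).symm

end

/-! ### The skew-symmetric antiderivative and differentiation under the integral sign. -/

section

variable {N L : ℕ}

open Matrix Filter Topology MeasureTheory

section SkewInt

/-- The kernel `½ sign (x - y)` of the skew-symmetric antiderivative. -/
noncomputable def skewKernel (z : ℝ × ℝ) : ℝ :=
  if z.2 < z.1 then 1 / 2 else if z.1 < z.2 then -(1 / 2) else 0

theorem measurable_skewKernel : Measurable skewKernel :=
  Measurable.ite (measurableSet_lt measurable_snd measurable_fst) measurable_const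
    (Measurable.ite (measurableSet_lt measurable_fst measurable_snd) measurable_const
      measurable_const)

theorem norm_skewKernel_le (z : ℝ × ℝ) : ‖skewKernel z‖ ≤ 1 := by
  unfold skewKernel
  split_ifs <;> norm_num

theorem skewKernel_swap (z : ℝ × ℝ) : skewKernel z.swap = -skewKernel z := by
  unfold skewKernel
  rcases lt_trichotomy z.1 z.2 with h | h | h
  · simp [h, h.not_gt]
  · simp [h]
  · simp [h, h.not_gt]

theorem integrable_skewKernel_mul {f g : ℝ → ℝ} (hf : Integrable f) (hg : Integrable g) :
    Integrable (fun z : ℝ × ℝ => skewKernel z * (f z.1 * g z.2)) (volume.prod volume) :=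
  (hf.mul_prod hg).bdd_mul measurable_skewKernel.aestronglyMeasurable
    (Eventually.of_forall norm_skewKernel_le)

theorem skewInt_eq {g : ℝ → ℝ} (hg : Integrable g) (x : ℝ) :
    skewInt g x = ∫ y, skewKernel (x, y) * g y := by
  have hi : Integrable (fun y => skewKernel (x, y) * g y) :=
    hg.bdd_mul (measurable_skewKernel.comp measurable_prodMk_left).aestronglyMeasurable
      (Eventually.of_forall fun _ => norm_skewKernel_le _)
  rw [← integral_add_compl measurableSet_Iic hi (s := Set.Iic x), Set.compl_Iic,
    integral_Iic_eq_integral_Iio, setIntegral_congr_fun measurableSet_Iio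
      (g := fun y => (1 / 2) * g y) fun y (hy : y < x) => by simp [skewKernel, hy],
    setIntegral_congr_fun measurableSet_Ioi
      (g := fun y => (-(1 / 2)) * g y) fun y (hy : x < y) => by simp [skewKernel, hy, hy.not_gt],
    integral_const_mul, integral_const_mul, skewInt, integral_Iic_eq_integral_Iio]
  ring

/-- As a double integral with a bounded antisymmetric kernel, the pairing is open to Fubini and to
differentiation under the integral. -/
theorem integral_mul_skewInt {f g : ℝ → ℝ} (hf : Integrable f) (hg : Integrable g) :
    Integrable (fun x => f x * skewInt g x) ∧
    ∫ x, f x * skewInt g x = ∫ z : ℝ × ℝ, skewKernel z * (f z.1 * g z.2) := by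
  have h := integrable_skewKernel_mul hf hg
  have e : (fun x => f x * skewInt g x) =
      fun x => ∫ y, skewKernel (x, y) * (f x * g y) := by
    ext x
    rw [skewInt_eq hg, ← integral_const_mul]
    congr 1
    ext y
    ring
  rw [e]
  exact ⟨h.integral_prod_left, (integral_prod _ h).symm⟩

theorem integral_mul_skewInt_skew {f g : ℝ → ℝ} (hf : Integrable f) (hg : Integrable g) :
    ∫ x, f x * skewInt g x = -∫ x, g x * skewInt f x := by
  rw [(integral_mul_skewInt hf hg).2, (integral_mul_skewInt hg hf).2, ← integral_neg,
    Measure.volume_eq_prod, ← integral_prod_swap]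
  congr 1
  ext z
  rw [skewKernel_swap]
  simp only [Prod.fst_swap, Prod.snd_swap]
  ring

theorem hasDerivAt_skewInt {g : ℝ → ℝ} (hg : Integrable g) (hc : Continuous g) (x : ℝ) :
    HasDerivAt (skewInt g) (g x) x := by
  -- Both half-line integrals are expressed through `∫_{-∞}^x g` and the total integral, leaving one
  -- interval integral plus a constant.
  have e : skewInt g = fun x => (∫ y in (0 : ℝ)..x, g y) + ((∫ y in Set.Iic 0, g y)
      - (1 / 2) * ∫ y, g y) := by
    ext x
    have h1 := integral_add_compl (measurableSet_Iic (a := x)) hg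
    have h2 := intervalIntegral.integral_Iic_sub_Iic (hg.integrableOn (s := Set.Iic 0))
      (hg.integrableOn (s := Set.Iic x))
    rw [Set.compl_Iic] at h1
    rw [skewInt, ← h1, ← h2]
    ring
  rw [e]
  exact (intervalIntegral.integral_hasDerivAt_right (hc.intervalIntegrable _ _)
    hc.stronglyMeasurable.stronglyMeasurableAtFilter hc.continuousAt).add_const _

theorem contDiff_skewInt {g : ℝ → ℝ} (hg : ContDiff ℝ ∞ g) (hs : HasCompactSupport g) :
    ContDiff ℝ ∞ (skewInt g) := by
  have h := hasDerivAt_skewInt (hg.continuous.integrable_of_hasCompactSupport hs) hg.continuous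
  rw [contDiff_infty_iff_deriv]
  exact ⟨fun x => (h x).differentiableAt, by rwa [show deriv (skewInt g) = g from
    funext fun x => (h x).deriv]⟩

end SkewInt

section Families

/-- A family of integrable functions of `x`, differentiable in the parameter `ε` near `0`,
and dominated together with its derivative `f'`. -/
structure DominatedFamily (f f' : ℝ → ℝ → ℝ) (δ : ℝ) (b : ℝ → ℝ) : Prop where
  pos : 0 < δ
  integrable_bound : Integrable b
  integrable : ∀ ε, |ε| < δ → Integrable (f ε)
  integrable_deriv : Integrable (f' 0)
  bound : ∀ ε, |ε| < δ → ∀ x, ‖f ε x‖ ≤ b x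
  bound_deriv : ∀ ε, |ε| < δ → ∀ x, ‖f' ε x‖ ≤ b x
  hasDerivAt : ∀ ε, |ε| < δ → ∀ x, HasDerivAt (fun ε => f ε x) (f' ε x) ε

theorem DominatedFamily.eventually {f f' : ℝ → ℝ → ℝ} {δ : ℝ} {b : ℝ → ℝ}
    (hf : DominatedFamily f f' δ b) : ∀ᶠ ε in 𝓝 (0 : ℝ), |ε| < δ := by
  filter_upwards [Metric.ball_mem_nhds (0 : ℝ) hf.pos] with ε hε
  simpa using hε

theorem DominatedFamily.hasDerivAt_integral {f f' g g' : ℝ → ℝ → ℝ} {δ δ' : ℝ} {b b' : ℝ → ℝ}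
    (hf : DominatedFamily f f' δ b) (hg : DominatedFamily g g' δ' b') :
    HasDerivAt (fun ε => ∫ x, f ε x * skewInt (g ε) x)
      ((∫ x, f' 0 x * skewInt (g 0) x) + ∫ x, f 0 x * skewInt (g' 0) x) 0 := by
  have hf0 := hf.integrable 0 (by simpa using hf.pos)
  have hg0 := hg.integrable 0 (by simpa using hg.pos)
  have I1 := integrable_skewKernel_mul hf.integrable_deriv hg0
  have I2 := integrable_skewKernel_mul hf0 hg.integrable_deriv
  have hnhds : {ε : ℝ | |ε| < δ ∧ |ε| < δ'} ∈ 𝓝 (0 : ℝ) := hf.eventually.and hg.eventually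
  have key := (hasDerivAt_integral_of_dominated_loc_of_deriv_le (μ := volume.prod volume)
    (F := fun ε (z : ℝ × ℝ) => skewKernel z * (f ε z.1 * g ε z.2))
    (F' := fun ε z => skewKernel z * (f' ε z.1 * g ε z.2 + f ε z.1 * g' ε z.2))
    (bound := fun z => 2 * (b z.1 * b' z.2)) hnhds
    (by
      filter_upwards [hnhds] with ε hε
      exact (integrable_skewKernel_mul (hf.integrable ε hε.1) (hg.integrable ε hε.2)).1)
    (integrable_skewKernel_mul hf0 hg0)
    (by simpa only [mul_add, Pi.add_def] using (I1.add I2).1)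
    (Eventually.of_forall fun z ε hε => by
      have b1 := hf.bound ε hε.1 z.1
      have b2 := hf.bound_deriv ε hε.1 z.1
      have b3 := hg.bound ε hε.2 z.2
      have b4 := hg.bound_deriv ε hε.2 z.2
      have hb := (norm_nonneg _).trans b1
      calc _ ≤ 1 * (‖f' ε z.1‖ * ‖g ε z.2‖ + ‖f ε z.1‖ * ‖g' ε z.2‖) := by
            rw [norm_mul]
            refine mul_le_mul (norm_skewKernel_le z) ?_ (norm_nonneg _) zero_le_one
            refine (norm_add_le _ _).trans ?_
            rw [norm_mul, norm_mul]
        _ ≤ 1 * (b z.1 * b' z.2 + b z.1 * b' z.2) := by gcongr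
        _ = _ := by ring)
    ((hf.integrable_bound.mul_prod hg.integrable_bound).const_mul 2)
    (Eventually.of_forall fun z ε hε =>
      ((hf.hasDerivAt ε hε.1 z.1).mul (hg.hasDerivAt ε hε.2 z.2)).const_mul _)).2
  rw [(integral_mul_skewInt hf.integrable_deriv hg0).2,
    (integral_mul_skewInt hf0 hg.integrable_deriv).2, Measure.volume_eq_prod,
    ← integral_add I1 I2]
  simp only [← mul_add]
  refine key.congr_of_eventuallyEq ?_
  filter_upwards [hnhds] with ε hε
  exact (integral_mul_skewInt (hf.integrable ε hε.1) (hg.integrable ε hε.2)).2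

theorem integrable_of_continuousOn_compact {K : Set ℝ} (hK : IsCompact K) {f : ℝ → ℝ}
    (hf : ContinuousOn f K) (h0 : ∀ x ∉ K, f x = 0) : Integrable f :=
  (integrableOn_iff_integrable_of_support_subset fun x hx => by
    by_contra h; exact hx (h0 x h)).1 (hf.integrableOn_compact hK)

/-- A family which is continuous with its derivative and supported in a fixed compact set is
dominated. -/
theorem exists_dominatedFamily {K : Set ℝ} (hK : IsCompact K) {f f' : ℝ → ℝ → ℝ} {δ : ℝ}
    (hδ : 0 < δ) (hf : ContinuousOn (fun z : ℝ × ℝ => f z.1 z.2) (Set.Icc (-δ) δ ×ˢ K))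
    (hf' : ContinuousOn (fun z : ℝ × ℝ => f' z.1 z.2) (Set.Icc (-δ) δ ×ˢ K))
    (h0 : ∀ ε, ∀ x ∉ K, f ε x = 0) (h0' : ∀ ε, ∀ x ∉ K, f' ε x = 0)
    (hd : ∀ ε, |ε| < δ → ∀ x ∈ K, HasDerivAt (fun ε => f ε x) (f' ε x) ε) :
    ∃ b, DominatedFamily f f' δ b := by
  obtain ⟨C, hC⟩ := (isCompact_Icc.prod hK).exists_bound_of_continuousOn hf
  obtain ⟨C', hC'⟩ := (isCompact_Icc.prod hK).exists_bound_of_continuousOn hf'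
  have hmem : ∀ ε, |ε| < δ → ε ∈ Set.Icc (-δ) δ := fun ε hε => abs_le.1 hε.le
  have hint : ∀ {g : ℝ → ℝ → ℝ},
      ContinuousOn (fun z : ℝ × ℝ => g z.1 z.2) (Set.Icc (-δ) δ ×ˢ K) →
      (∀ ε, ∀ x ∉ K, g ε x = 0) → ∀ ε, |ε| < δ → Integrable (g ε) := fun {g} hg hg0 ε hε =>
    integrable_of_continuousOn_compact hK
      (hg.comp (f := fun x => (ε, x)) (by fun_prop) fun x hx => ⟨hmem ε hε, hx⟩) (hg0 ε)
  have hbd : ∀ {g : ℝ → ℝ → ℝ} {D : ℝ}, D ≤ max C C' →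
      (∀ z ∈ Set.Icc (-δ) δ ×ˢ K, ‖g z.1 z.2‖ ≤ D) → (∀ ε, ∀ x ∉ K, g ε x = 0) →
      ∀ ε, |ε| < δ → ∀ x, ‖g ε x‖ ≤ K.indicator (fun _ => max C C') x := by
    intro g D hD hg hg0 ε hε x
    by_cases hx : x ∈ K
    · rw [Set.indicator_of_mem hx]
      exact (hg (ε, x) ⟨hmem ε hε, hx⟩).trans hD
    · rw [Set.indicator_of_notMem hx, hg0 ε x hx, norm_zero]
  refine ⟨K.indicator fun _ => max C C', hδ, ?_, hint hf h0, hint hf' h0' 0 (by simpa using hδ),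
    hbd (le_max_left _ _) hC h0, hbd (le_max_right _ _) hC' h0', fun ε hε x => ?_⟩
  · exact (integrable_indicator_iff hK.measurableSet).2
      (integrableOn_const hK.measure_lt_top.ne)
  · by_cases hx : x ∈ K
    · exact hd ε hε x hx
    · have : (fun ε => f ε x) = fun _ => 0 := funext fun ε => h0 ε x hx
      rw [this, h0' ε x hx]
      exact hasDerivAt_const _ _

/-- A curve stays in an open set over a compact set of parameters under small perturbations. -/
theorem exists_perturbation_mem {U : Set (Coord N)} (hU : IsOpen U) {u v : ℝ → Coord N}
    (hu : Continuous u) (hv : Continuous v) {K : Set ℝ} (hK : IsCompact K)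
    (h : ∀ x ∈ K, u x ∈ U) :
    ∃ δ : ℝ, 0 < δ ∧ ∀ ε ∈ Set.Icc (-δ) δ, ∀ x ∈ K, u x + ε • v x ∈ U := by
  have hc : Continuous fun z : ℝ × ℝ => u z.2 + z.1 • v z.2 := by fun_prop
  have : ∀ᶠ ε in 𝓝 (0 : ℝ), ∀ x ∈ K, u x + ε • v x ∈ U :=
    hK.eventually_forall_of_forall_eventually fun x hx =>
      hc.continuousAt.eventually_mem (hU.mem_nhds (by simpa using h x hx))
  obtain ⟨δ, hδ, hball⟩ := Metric.eventually_nhds_iff_ball.1 this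
  -- Halving makes the closed parameter interval fit into the open ball.
  refine ⟨δ / 2, by positivity, fun ε hε => hball ε ?_⟩
  rw [mem_ball_zero_iff, Real.norm_eq_abs]
  linarith [abs_le.2 hε]

end Families

end

/-! ### First variation of the right factor of `M₁`. -/

section

variable {N L : ℕ}

open Matrix Filter Topology MeasureTheory

variable {U : Set (Coord N)} {η : Matrix (Fin N) (Fin N) ℝ}
  {μ : Matrix (Fin L) (Fin L) ℝ} {ψ : Fin L → Coord N → ℝ}

theorem rightFactor_eq_zero (u ξ : ℝ → Coord N) (n : Fin L) {x : ℝ} (h : x ∉ tsupport ξ) :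
    rightFactor η ψ u ξ n x = 0 := by
  simp [rightFactor, image_eq_zero_of_notMem_tsupport h]

theorem hasCompactSupport_rightFactor (u : ℝ → Coord N) {ξ : ℝ → Coord N} (hξ : IsTest ξ)
    (n : Fin L) : HasCompactSupport (rightFactor η ψ u ξ n) :=
  HasCompactSupport.intro hξ.2 fun _ hx => rightFactor_eq_zero u ξ n hx

theorem contDiff_deriv_infty {u : ℝ → Coord N} (hu : ContDiff ℝ ∞ u) :
    ContDiff ℝ ∞ (deriv u) := (contDiff_infty_iff_deriv.1 hu).2

theorem contDiff_pd2_comp (hU : IsOpen U) {f : Coord N → ℝ} (hf : ContDiffOn ℝ ∞ f U)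
    {u : ℝ → Coord N} (hu : IsField U u) (i j : Fin N) :
    ContDiff ℝ ∞ (fun x => pd2 i j f (u x)) :=
  (contDiffOn_pd2 hU hf i j).comp_contDiff hu.1 hu.2

theorem contDiff_rightFactor (S : Setting U η μ ψ) {u ξ : ℝ → Coord N} (hu : IsField U u)
    (hξ : IsTest ξ) (n : Fin L) : ContDiff ℝ ∞ (rightFactor η ψ u ξ n) :=
  ContDiff.sum fun j _ => ContDiff.sum fun r _ => ContDiff.sum fun s _ =>
    ((contDiff_const.mul (contDiff_pd2_comp S.isOpen (S.smooth n) hu r s)).mul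
      (contDiff_pi.1 (contDiff_deriv_infty hu.1) s)).mul (contDiff_pi.1 hξ.1 j)

theorem contDiff_leftFactor (S : Setting U η μ ψ) {u : ℝ → Coord N} (hu : IsField U u)
    {P : Fin L → ℝ → ℝ} (hP : ∀ n, ContDiff ℝ ∞ (P n)) :
    ContDiff ℝ ∞ (leftFactor η μ ψ u P) :=
  contDiff_pi.2 fun _ => ContDiff.sum fun m _ => ContDiff.sum fun n _ => ContDiff.sum fun p _ =>
    ContDiff.sum fun k _ =>
      ((contDiff_const.mul (contDiff_pd2_comp S.isOpen (S.smooth m) hu p k)).mul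
        (contDiff_pi.1 (contDiff_deriv_infty hu.1) k)).mul (hP n)

theorem contDiff_skewInt_rightFactor (S : Setting U η μ ψ) {u ξ : ℝ → Coord N}
    (hu : IsField U u) (hξ : IsTest ξ) (n : Fin L) :
    ContDiff ℝ ∞ (skewInt (rightFactor η ψ u ξ n)) :=
  contDiff_skewInt (contDiff_rightFactor S hu hξ n) (hasCompactSupport_rightFactor u hξ n)

theorem IsTest.mulVec {ξ : ℝ → Coord N} (hξ : IsTest ξ) (A : Matrix (Fin N) (Fin N) ℝ) :
    IsTest (fun x => A *ᵥ ξ x) :=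
  ⟨contDiff_pi.2 fun i => ContDiff.sum (s := Finset.univ) (f := fun j x => A i j * ξ x j)
      fun j _ => contDiff_const.mul (contDiff_pi.1 hξ.1 j),
    hξ.2.comp_left (g := fun a => A *ᵥ a) (mulVec_zero A)⟩

theorem IsTest.deriv {ξ : ℝ → Coord N} (hξ : IsTest ξ) : IsTest (deriv ξ) :=
  ⟨contDiff_deriv_infty hξ.1, hξ.2.deriv⟩

theorem contDiff_M2op {ξ : ℝ → Coord N} (hξ : IsTest ξ) : ContDiff ℝ ∞ (M2op η ξ) :=
  (hξ.deriv.mulVec η).1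

theorem continuous_dotProduct {ξ ζ : ℝ → Coord N} (hξ : Continuous ξ) (hζ : Continuous ζ) :
    Continuous fun x => ξ x ⬝ᵥ ζ x := by
  simp only [dotProduct]
  fun_prop

theorem integrable_dotProduct {ξ ζ : ℝ → Coord N} (hξ : IsTest ξ) (hζ : Continuous ζ) :
    Integrable fun x => ξ x ⬝ᵥ ζ x :=
  (continuous_dotProduct hξ.1.continuous hζ).integrable_of_hasCompactSupport
    (HasCompactSupport.intro hξ.2 fun x hx => by
      rw [image_eq_zero_of_notMem_tsupport hx, zero_dotProduct])

theorem continuousOn_dotProduct {X : Type*} [TopologicalSpace X] {s : Set X} {a b : X → Coord N}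
    (ha : ∀ j, ContinuousOn (fun z => a z j) s) (hb : ∀ j, ContinuousOn (fun z => b z j) s) :
    ContinuousOn (fun z => a z ⬝ᵥ b z) s :=
  continuousOn_finsetSum _ fun j _ => (ha j).mul (hb j)

theorem HasDerivAt.dotProduct {a b : ℝ → Coord N} {a' b' : Coord N} {x : ℝ}
    (ha : HasDerivAt a a' x) (hb : HasDerivAt b b' x) :
    HasDerivAt (fun y => a y ⬝ᵥ b y) (a' ⬝ᵥ b x + a x ⬝ᵥ b') x := by
  simp only [_root_.dotProduct, ← Finset.sum_add_distrib]
  exact HasDerivAt.fun_sum fun i _ => (hasDerivAt_pi.1 ha i).mul (hasDerivAt_pi.1 hb i)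

/-- The first variation of the right factor along `v`. -/
noncomputable def rightFactorVar (η : Matrix (Fin N) (Fin N) ℝ) (ψ : Fin L → Coord N → ℝ)
    (u v ξ : ℝ → Coord N) (n : Fin L) (ε x : ℝ) : ℝ :=
  (η *ᵥ ξ x) ⬝ᵥ hessVar (ψ n) (u x + ε • v x) (v x) (deriv u x + ε • deriv v x) (deriv v x)

theorem rightFactorVar_eq_zero (u v ξ : ℝ → Coord N) (n : Fin L) (ε : ℝ) {x : ℝ}
    (h : x ∉ tsupport ξ) : rightFactorVar η ψ u v ξ n ε x = 0 := by
  simp [rightFactorVar, image_eq_zero_of_notMem_tsupport h]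

theorem rightFactor_perturbed (hη : η.IsSymm) {u v : ℝ → Coord N} (hu : ContDiff ℝ ∞ u)
    (hv : ContDiff ℝ ∞ v) (ξ : ℝ → Coord N) (n : Fin L) (ε x : ℝ) :
    rightFactor η ψ (u + ε • v) ξ n x =
      (η *ᵥ ξ x) ⬝ᵥ (hess (ψ n) (u x + ε • v x) *ᵥ (deriv u x + ε • deriv v x)) := by
  rw [rightFactor_eq hη, form]
  have h1 := (hu.differentiable (by simp) x).hasDerivAt
  have h2 := (hv.differentiable (by simp) x).hasDerivAt
  rw [(h1.add (h2.const_smul ε)).deriv]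
  rfl

/-- The perturbed curve `u + ε • v` may leave `U` far away, as `v` need not have compact support.
Only the compact support of `ξ` matters, and over it the curve stays in `U` for small `ε`. -/
theorem exists_dominatedFamily_rightFactor (S : Setting U η μ ψ) {u v ξ : ℝ → Coord N}
    (hu : IsField U u) (hv : ContDiff ℝ ∞ v) (hξ : IsTest ξ) (n : Fin L) :
    ∃ δ b, DominatedFamily (fun ε => rightFactor η ψ (u + ε • v) ξ n)
      (rightFactorVar η ψ u v ξ n) δ b := by
  have hU := S.isOpen
  obtain ⟨δ, hδ, hmem⟩ := exists_perturbation_mem hU hu.1.continuous hv.continuous hξ.2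
    (fun x _ => hu.2 x)
  have cw : ContinuousOn (fun z : ℝ × ℝ => u z.2 + z.1 • v z.2)
      (Set.Icc (-δ) δ ×ˢ tsupport ξ) := by
    have h1 := hu.1.continuous
    have h2 := hv.continuous
    fun_prop
  have mw : Set.MapsTo (fun z : ℝ × ℝ => u z.2 + z.1 • v z.2)
      (Set.Icc (-δ) δ ×ˢ tsupport ξ) U := fun z hz => hmem z.1 hz.1 z.2 hz.2
  have ca : ∀ j, ContinuousOn (fun z : ℝ × ℝ => (η *ᵥ ξ z.2) j)
      (Set.Icc (-δ) δ ×ˢ tsupport ξ) := fun j =>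
    ((contDiff_pi.1 (hξ.mulVec η).1 j).continuous.comp continuous_snd).continuousOn
  have cu : ∀ j, ContinuousOn (fun z : ℝ × ℝ => (deriv u z.2 + z.1 • deriv v z.2) j)
      (Set.Icc (-δ) δ ×ˢ tsupport ξ) := by
    intro j
    have h1 := (contDiff_deriv_infty hu.1).continuous
    have h2 := (contDiff_deriv_infty hv).continuous
    simp only [Pi.add_apply, Pi.smul_apply]
    fun_prop
  have cv : ∀ j, ContinuousOn (fun z : ℝ × ℝ => v z.2 j) (Set.Icc (-δ) δ ×ˢ tsupport ξ) := by
    intro j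
    have h2 := hv.continuous
    fun_prop
  have cv' : ∀ j, ContinuousOn (fun z : ℝ × ℝ => deriv v z.2 j)
      (Set.Icc (-δ) δ ×ˢ tsupport ξ) := by
    intro j
    have h2 := (contDiff_deriv_infty hv).continuous
    fun_prop
  have ch : ∀ j k, ContinuousOn (fun z : ℝ × ℝ => pd2 j k (ψ n) (u z.2 + z.1 • v z.2))
      (Set.Icc (-δ) δ ×ˢ tsupport ξ) := fun j k =>
    (contDiffOn_pd2 hU (S.smooth n) j k).continuousOn.comp cw mw
  have ch' : ∀ l j k, ContinuousOn (fun z : ℝ × ℝ => pd l (pd2 j k (ψ n)) (u z.2 + z.1 • v z.2))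
      (Set.Icc (-δ) δ ×ˢ tsupport ξ) := fun l j k =>
    (contDiffOn_pd hU (contDiffOn_pd2 hU (S.smooth n) j k) l).continuousOn.comp cw mw
  refine ⟨δ, exists_dominatedFamily hξ.2 hδ ?_ ?_
    (fun ε x hx => rightFactor_eq_zero _ ξ n hx)
    (fun ε x hx => rightFactorVar_eq_zero u v ξ n ε hx) fun ε hε x hx => ?_⟩
  · simp only [rightFactor_perturbed S.symm_η hu.1 hv]
    exact continuousOn_dotProduct ca fun j => continuousOn_dotProduct (ch j) cu
  · refine continuousOn_dotProduct ca fun j => ?_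
    unfold hessVar
    exact continuousOn_finsetSum _ fun k _ => ((continuousOn_finsetSum _ fun l _ =>
        (ch' l j k).mul (cv l)).mul (cu k)).add ((ch j k).mul (cv' k))
  · simp only [rightFactor_perturbed S.symm_η hu.1 hv]
    have hlin : ∀ a b : Coord N, HasDerivAt (fun ε : ℝ => a + ε • b) b ε := fun a b => by
      simpa using ((hasDerivAt_id ε).smul_const b).const_add a
    simpa [rightFactorVar] using HasDerivAt.dotProduct (hasDerivAt_const ε (η *ᵥ ξ x)) (hasDerivAt_hess_mulVec hU
      (S.smooth n) (hmem ε (abs_le.1 hε.le) x hx) (hlin (u x) (v x)) (hlin (deriv u x) (deriv v x)))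

/-- The matrix `μ^{mn} R_n ∂²ψ_m` at the point `x` of a field. -/
noncomputable def hessComb (μ : Matrix (Fin L) (Fin L) ℝ) (ψ : Fin L → Coord N → ℝ)
    (u : ℝ → Coord N) (R : Fin L → ℝ → ℝ) (x : ℝ) : Matrix (Fin N) (Fin N) ℝ :=
  ∑ m, ∑ n, (μ m n * R n x) • hess (ψ m) (u x)

theorem contract_form_eq (u : ℝ → Coord N) (R : Fin L → ℝ → ℝ) (x : ℝ) (a b : Coord N) :
    contract μ (fun m => form (hess (ψ m) (u x)) a b) (fun n => R n x) =
      a ⬝ᵥ (hessComb μ ψ u R x *ᵥ b) := by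
  simp only [hessComb, sum_mulVec, smul_mulVec, dotProduct_sum, dotProduct_smul, contract, form,
    smul_eq_mul]
  exact Finset.sum_congr rfl fun m _ => Finset.sum_congr rfl fun n _ => by ring

theorem hessComb_isSymm (S : Setting U η μ ψ) {u : ℝ → Coord N} {x : ℝ} (hx : u x ∈ U)
    (R : Fin L → ℝ → ℝ) : (hessComb μ ψ u R x).IsSymm := by
  unfold hessComb Matrix.IsSymm
  simp only [transpose_sum, transpose_smul, (S.hess_symm hx _).eq]

theorem hessComb_mul_comm (S : Setting U η μ ψ) {u : ℝ → Coord N} {x : ℝ} (hx : u x ∈ U)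
    (R T : Fin L → ℝ → ℝ) :
    hessComb μ ψ u R x * η * hessComb μ ψ u T x = hessComb μ ψ u T x * η * hessComb μ ψ u R x := by
  have h : ∀ n, hess (ψ n) (u x) * η * hessComb μ ψ u T x =
      hessComb μ ψ u T x * η * hess (ψ n) (u x) := fun n => by
    simp only [hessComb, Finset.sum_mul, Finset.mul_sum, smul_mul_assoc, Matrix.mul_smul,
      S.comm.mul_comm hx n]
  rw [hessComb]
  simp only [Finset.sum_mul, Finset.mul_sum, smul_mul_assoc, Matrix.mul_smul, h]

theorem hasDerivAt_contract {f g : Fin L → ℝ → ℝ} {f' g' : Fin L → ℝ} {x : ℝ}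
    (hf : ∀ m, HasDerivAt (f m) (f' m) x) (hg : ∀ n, HasDerivAt (g n) (g' n) x) :
    HasDerivAt (fun y => contract μ (fun m => f m y) (fun n => g n y))
      (contract μ f' (fun n => g n x) + contract μ (fun m => f m x) g') x := by
  simp only [contract, ← Finset.sum_add_distrib]
  exact HasDerivAt.fun_sum fun m _ => HasDerivAt.fun_sum fun n _ =>
    ((hf m).const_mul _).mul (hg n)

theorem contract_add_left (x x' y : Fin L → ℝ) :
    contract μ (fun m => x m + x' m) y = contract μ x y + contract μ x' y := by
  simp only [contract, ← Finset.sum_add_distrib]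
  exact Finset.sum_congr rfl fun m _ => Finset.sum_congr rfl fun n _ => by ring

theorem contract_zero_left (y : Fin L → ℝ) : contract μ (fun _ => 0) y = 0 := by
  simp [contract]

end

/-! ### Skew-symmetry and the Jacobi identity for `a M₁ + b M₂`. -/

section

variable {N L : ℕ}

open Matrix Filter Topology MeasureTheory

variable {U : Set (Coord N)} {η : Matrix (Fin N) (Fin N) ℝ}
  {μ : Matrix (Fin L) (Fin L) ℝ} {ψ : Fin L → Coord N → ℝ}

theorem integrable_contract {f g : Fin L → ℝ → ℝ}
    (h : ∀ m n, Integrable fun x => f m x * g n x) :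
    Integrable fun x => contract μ (fun m => f m x) (fun n => g n x) := by
  simp only [contract, mul_assoc]
  exact integrable_finsetSum _ fun m _ => integrable_finsetSum _ fun n _ => (h m n).const_mul _

theorem integral_contract {f g : Fin L → ℝ → ℝ}
    (h : ∀ m n, Integrable fun x => f m x * g n x) :
    ∫ x, contract μ (fun m => f m x) (fun n => g n x) =
      ∑ m, ∑ n, μ m n * ∫ x, f m x * g n x := by
  simp only [contract, mul_assoc]
  have h' : ∀ m n, Integrable fun x => μ m n * (f m x * g n x) := fun m n => (h m n).const_mul _
  rw [integral_finsetSum _ fun m _ => integrable_finsetSum _ fun n _ => h' m n]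
  refine Finset.sum_congr rfl fun m _ => ?_
  rw [integral_finsetSum _ fun n _ => h' m n]
  exact Finset.sum_congr rfl fun n _ => integral_const_mul _ _

theorem integrable_rightFactor (S : Setting U η μ ψ) {u ξ : ℝ → Coord N} (hu : IsField U u)
    (hξ : IsTest ξ) (n : Fin L) : Integrable (rightFactor η ψ u ξ n) :=
  (contDiff_rightFactor S hu hξ n).continuous.integrable_of_hasCompactSupport
    (hasCompactSupport_rightFactor u hξ n)

/-- Only integrability of the right factors is required of `w`, so that the formula covers perturbed
curves that are not fields in `U`. -/
theorem pairing_eq (hη : η.IsSymm) {w ξ ζ : ℝ → Coord N} (hξ : IsTest ξ) (hζ : IsTest ζ)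
    (h1 : ∀ n, Integrable (rightFactor η ψ w ξ n)) (h2 : ∀ n, Integrable (rightFactor η ψ w ζ n))
    (a b : ℝ) :
    pairing ξ (a • M1op η μ ψ w ζ + b • M2op η ζ) =
      a * (∑ m, ∑ n, μ m n *
        ∫ x, rightFactor η ψ w ξ m x * skewInt (rightFactor η ψ w ζ n) x) +
      b * ∫ x, ξ x ⬝ᵥ M2op η ζ x := by
  have hi := fun m n => (integral_mul_skewInt (h1 m) (h2 n)).1
  have e : ∀ x, ∑ i, ξ x i * (a • M1op η μ ψ w ζ + b • M2op η ζ) x i =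
      a * contract μ (fun m => rightFactor η ψ w ξ m x)
        (fun n => skewInt (rightFactor η ψ w ζ n) x) + b * (ξ x ⬝ᵥ M2op η ζ x) := by
    intro x
    change ξ x ⬝ᵥ (a • M1op η μ ψ w ζ x + b • M2op η ζ x) = _
    rw [dotProduct_add, dotProduct_smul, dotProduct_smul, M1op, dotProduct_leftFactor hη]
    simp only [rightFactor_eq hη w ξ, smul_eq_mul]
  unfold pairing
  simp only [e]
  rw [integral_add ((integrable_contract hi).const_mul a)
    ((integrable_dotProduct hξ (contDiff_M2op hζ).continuous).const_mul b),
    integral_const_mul, integral_const_mul, integral_contract hi]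

theorem integral_dotProduct_M2op_skew (hη : η.IsSymm) {ξ ζ : ℝ → Coord N} (hξ : IsTest ξ)
    (hζ : IsTest ζ) :
    ∫ x, ξ x ⬝ᵥ M2op η ζ x = -∫ x, ζ x ⬝ᵥ M2op η ξ x := by
  have i1 := integrable_dotProduct hξ (contDiff_M2op (η := η) hζ).continuous
  have i2 := integrable_dotProduct hζ (contDiff_M2op (η := η) hξ).continuous
  rw [eq_neg_iff_add_eq_zero, ← integral_add i1 i2]
  refine integral_eq_zero_of_hasDerivAt_of_integrable (f := fun x => ξ x ⬝ᵥ (η *ᵥ ζ x))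
    (fun x => ?_) (i1.add i2) (integrable_dotProduct hξ (hζ.mulVec η).1.continuous)
  have d1 := (hξ.1.differentiable (by simp) x).hasDerivAt
  have d2 := (hζ.1.differentiable (by simp) x).hasDerivAt
  refine (HasDerivAt.dotProduct d1 (HasDerivAt.mulVec_const d2 η)).congr_deriv ?_
  rw [dotProduct_mulVec_symm hη (deriv ξ x), dotProduct_comm (η *ᵥ deriv ξ x), add_comm]
  rfl

/-- The operators `a M₁ + b M₂` are skew-symmetric. -/
theorem pairing_skew (S : Setting U η μ ψ) {u ξ ζ : ℝ → Coord N} (hu : IsField U u)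
    (hξ : IsTest ξ) (hζ : IsTest ζ) (a b : ℝ) :
    pairing ξ (a • M1op η μ ψ u ζ + b • M2op η ζ) =
      -pairing ζ (a • M1op η μ ψ u ξ + b • M2op η ξ) := by
  have h1 := integrable_rightFactor S hu hξ
  have h2 := integrable_rightFactor S hu hζ
  rw [pairing_eq S.symm_η hξ hζ h1 h2, pairing_eq S.symm_η hζ hξ h2 h1,
    integral_dotProduct_M2op_skew S.symm_η hξ hζ, Finset.sum_comm, neg_add, ← mul_neg, ← mul_neg,
    ← Finset.sum_neg_distrib]
  congr 2
  refine Finset.sum_congr rfl fun m _ => ?_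
  rw [← Finset.sum_neg_distrib]
  refine Finset.sum_congr rfl fun n _ => ?_
  rw [integral_mul_skewInt_skew (h1 n) (h2 m), S.symm_μ.apply, mul_neg]

/-- The density of the derivative of `⟨ξ, M₁ ζ⟩` along `v`. -/
noncomputable def varDensity (η : Matrix (Fin N) (Fin N) ℝ) (μ : Matrix (Fin L) (Fin L) ℝ)
    (ψ : Fin L → Coord N → ℝ) (u v ξ ζ : ℝ → Coord N) (x : ℝ) : ℝ :=
  contract μ (fun m => rightFactorVar η ψ u v ξ m 0 x)
      (fun n => skewInt (rightFactor η ψ u ζ n) x) -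
    contract μ (fun m => rightFactorVar η ψ u v ζ m 0 x)
      (fun n => skewInt (rightFactor η ψ u ξ n) x)

/-- The product rule varies either right factor. Skewness of the antiderivative moves it off the
varied factor in the second term, which produces the minus sign in `varDensity`; the `M₂` part does
not depend on `ε`. -/
theorem hasDerivAt_pairing (S : Setting U η μ ψ) {u v ξ ζ : ℝ → Coord N} (hu : IsField U u)
    (hv : ContDiff ℝ ∞ v) (hξ : IsTest ξ) (hζ : IsTest ζ) (a b : ℝ) :
    Integrable (varDensity η μ ψ u v ξ ζ) ∧
    HasDerivAt (fun ε : ℝ => pairing ξ (a • M1op η μ ψ (u + ε • v) ζ + b • M2op η ζ))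
      (a * ∫ x, varDensity η μ ψ u v ξ ζ x) 0 := by
  choose δ c hf using exists_dominatedFamily_rightFactor S hu hv hξ
  choose δ' c' hg using exists_dominatedFamily_rightFactor S hu hv hζ
  have h1 := integrable_rightFactor S hu hξ
  have h2 := integrable_rightFactor S hu hζ
  have i1 := fun m n => (integral_mul_skewInt (hf m).integrable_deriv (h2 n)).1
  have i2 := fun m n => (integral_mul_skewInt (hg m).integrable_deriv (h1 n)).1
  refine ⟨(integrable_contract i1).sub (integrable_contract i2), ?_⟩
  have key := ((HasDerivAt.fun_sum (u := Finset.univ) fun m _ =>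
    HasDerivAt.fun_sum (u := Finset.univ) fun n _ =>
      ((hf m).hasDerivAt_integral (hg n)).const_mul (μ m n)).const_mul a).add_const
        (b * ∫ x, ξ x ⬝ᵥ M2op η ζ x)
  simp only [zero_smul, add_zero] at key
  refine (key.congr_of_eventuallyEq ?_).congr_deriv ?_
  · filter_upwards [eventually_all.2 fun m => (hf m).eventually,
      eventually_all.2 fun m => (hg m).eventually] with ε hε hε'
    exact pairing_eq S.symm_η hξ hζ (fun n => (hf n).integrable ε (hε n))
      (fun n => (hg n).integrable ε (hε' n)) a b
  · unfold varDensity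
    rw [integral_sub (integrable_contract i1) (integrable_contract i2), integral_contract i1,
      integral_contract i2, Finset.sum_comm (f := fun m n => μ m n * ∫ x,
        rightFactorVar η ψ u v ζ m 0 x * _), ← Finset.sum_sub_distrib]
    congr 1
    refine Finset.sum_congr rfl fun m _ => ?_
    rw [← Finset.sum_sub_distrib]
    refine Finset.sum_congr rfl fun n _ => ?_
    rw [integral_mul_skewInt_skew (h1 m) (hg n).integrable_deriv, S.symm_μ.apply]
    ring

/-- The skew-symmetrized primitive of the first variation. -/
noncomputable def varPrimitive (η : Matrix (Fin N) (Fin N) ℝ) (μ : Matrix (Fin L) (Fin L) ℝ)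
    (ψ : Fin L → Coord N → ℝ) (u v ξ ζ : ℝ → Coord N) (x : ℝ) : ℝ :=
  contract μ (fun m => (η *ᵥ ξ x) ⬝ᵥ (hess (ψ m) (u x) *ᵥ v x))
      (fun n => skewInt (rightFactor η ψ u ζ n) x) -
    contract μ (fun m => (η *ᵥ ζ x) ⬝ᵥ (hess (ψ m) (u x) *ᵥ v x))
      (fun n => skewInt (rightFactor η ψ u ξ n) x)

/-- The three terms come from differentiating `ξ`, then `Hess ψ_m · v` (a variation along `v`, by
`hessVar_symm`), then the antiderivative. -/
theorem hasDerivAt_varTerm (S : Setting U η μ ψ) {u v ξ ζ : ℝ → Coord N} (hu : IsField U u)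
    (hv : ContDiff ℝ ∞ v) (hξ : IsTest ξ) (hζ : IsTest ζ) (x : ℝ) :
    HasDerivAt (fun x => contract μ (fun m => (η *ᵥ ξ x) ⬝ᵥ (hess (ψ m) (u x) *ᵥ v x))
      (fun n => skewInt (rightFactor η ψ u ζ n) x))
      ((η *ᵥ deriv ξ x) ⬝ᵥ
          (hessComb μ ψ u (fun n => skewInt (rightFactor η ψ u ζ n)) x *ᵥ v x) +
        contract μ (fun m => rightFactorVar η ψ u v ξ m 0 x)
          (fun n => skewInt (rightFactor η ψ u ζ n) x) +
        contract μ (fun m => form (hess (ψ m) (u x)) (η *ᵥ ξ x) (v x))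
          (fun n => form (hess (ψ n) (u x)) (η *ᵥ ζ x) (deriv u x))) x := by
  have dξ := (hξ.1.differentiable (by simp) x).hasDerivAt
  have dv := (hv.differentiable (by simp) x).hasDerivAt
  refine (hasDerivAt_contract
    (fun m => HasDerivAt.dotProduct (HasDerivAt.mulVec_const dξ η)
      (hasDerivAt_hess_mulVec S.isOpen (S.smooth m) (hu.2 x) (hu.hasDerivAt x) dv))
    (fun n => hasDerivAt_skewInt (integrable_rightFactor S hu hζ n)
      (contDiff_rightFactor S hu hζ n).continuous x)).congr_deriv ?_
  rw [contract_add_left, ← contract_form_eq]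
  simp only [rightFactorVar, zero_smul, add_zero, rightFactor_eq S.symm_η u ζ,
    hessVar_symm S.isOpen (S.smooth _) (hu.2 x) (v x)]
  rfl

theorem hasDerivAt_varPrimitive (S : Setting U η μ ψ) {u v ξ ζ : ℝ → Coord N} (hu : IsField U u)
    (hv : ContDiff ℝ ∞ v) (hξ : IsTest ξ) (hζ : IsTest ζ) (x : ℝ) :
    HasDerivAt (varPrimitive η μ ψ u v ξ ζ)
      (varDensity η μ ψ u v ξ ζ x +
        ((η *ᵥ deriv ξ x) ⬝ᵥ
          (hessComb μ ψ u (fun n => skewInt (rightFactor η ψ u ζ n)) x *ᵥ v x) -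
        (η *ᵥ deriv ζ x) ⬝ᵥ
          (hessComb μ ψ u (fun n => skewInt (rightFactor η ψ u ξ n)) x *ᵥ v x))) x := by
  refine ((hasDerivAt_varTerm S hu hv hξ hζ x).sub
    (hasDerivAt_varTerm S hu hv hζ hξ x)).congr_deriv ?_
  -- The terms free of antiderivatives are symmetric in `ξ` and `ζ` by the Gauss equations, so they
  -- cancel in the difference.
  have e : contract μ (fun m => form (hess (ψ m) (u x)) (η *ᵥ ξ x) (v x))
      (fun n => form (hess (ψ n) (u x)) (η *ᵥ ζ x) (deriv u x)) =
      contract μ (fun m => form (hess (ψ m) (u x)) (η *ᵥ ζ x) (v x))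
      (fun n => form (hess (ψ n) (u x)) (η *ᵥ ξ x) (deriv u x)) := by
    simp only [S.form_comm (hu.2 x) _ _ (v x)]
    exact S.swap (hu.2 x) _ _ _ _
  rw [e, varDensity]
  ring

theorem integrable_varPrimitive (S : Setting U η μ ψ) {u v ξ ζ : ℝ → Coord N} (hu : IsField U u)
    (hv : ContDiff ℝ ∞ v) (hξ : IsTest ξ) (hζ : IsTest ζ) :
    Integrable (varPrimitive η μ ψ u v ξ ζ) := by
  have hc : Continuous (varPrimitive η μ ψ u v ξ ζ) := continuous_iff_continuousAt.2 fun x =>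
    (hasDerivAt_varPrimitive S hu hv hξ hζ x).continuousAt
  -- The antiderivatives need not have compact support, but each term carries an undifferentiated
  -- factor `ξ` or `ζ`.
  refine hc.integrable_of_hasCompactSupport (HasCompactSupport.intro (hξ.2.union hζ.2) ?_)
  intro x hx
  rw [Set.mem_union, not_or] at hx
  simp [varPrimitive, image_eq_zero_of_notMem_tsupport hx.1,
    image_eq_zero_of_notMem_tsupport hx.2, contract_zero_left]

/-- The cyclic sum of the remainders vanishes for Hamiltonian vector fields. -/
theorem cyclic_sum_eq_zero {A₁ A₂ A₃ : Matrix (Fin N) (Fin N) ℝ}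
    (h1 : A₁.IsSymm) (h2 : A₂.IsSymm) (h3 : A₃.IsSymm)
    (h12 : A₁ * η * A₂ = A₂ * η * A₁) (h23 : A₂ * η * A₃ = A₃ * η * A₂)
    (h31 : A₃ * η * A₁ = A₁ * η * A₃) (a b : ℝ) (w x₁ x₂ x₃ : Coord N) :
    (x₁ ⬝ᵥ (A₂ *ᵥ (a • (η *ᵥ (A₃ *ᵥ w)) + b • x₃)) -
        x₂ ⬝ᵥ (A₁ *ᵥ (a • (η *ᵥ (A₃ *ᵥ w)) + b • x₃))) +
      (x₂ ⬝ᵥ (A₃ *ᵥ (a • (η *ᵥ (A₁ *ᵥ w)) + b • x₁)) -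
        x₃ ⬝ᵥ (A₂ *ᵥ (a • (η *ᵥ (A₁ *ᵥ w)) + b • x₁))) +
      (x₃ ⬝ᵥ (A₁ *ᵥ (a • (η *ᵥ (A₂ *ᵥ w)) + b • x₂)) -
        x₁ ⬝ᵥ (A₃ *ᵥ (a • (η *ᵥ (A₂ *ᵥ w)) + b • x₂))) = 0 := by
  -- The `b`-terms cancel by symmetry of the `Aᵢ`, the `a`-terms by commutation through `η`.
  have f1 : x₂ ⬝ᵥ (A₁ *ᵥ x₃) = x₃ ⬝ᵥ (A₁ *ᵥ x₂) := form_comm h1 _ _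
  have f2 : x₁ ⬝ᵥ (A₂ *ᵥ x₃) = x₃ ⬝ᵥ (A₂ *ᵥ x₁) := form_comm h2 _ _
  have f3 : x₁ ⬝ᵥ (A₃ *ᵥ x₂) = x₂ ⬝ᵥ (A₃ *ᵥ x₁) := form_comm h3 _ _
  simp only [mulVec_add, mulVec_smul, dotProduct_add, dotProduct_smul, smul_eq_mul, mulVec_mulVec,
    ← Matrix.mul_assoc, h12, h23, h31, f1, f2, f3]
  ring

/-- `a M₁ + b M₂` is a Hamiltonian operator. -/
theorem isHamiltonian (S : Setting U η μ ψ) (a b : ℝ) :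
    IsHamiltonian U (fun u ξ => a • M1op η μ ψ u ξ + b • M2op η ξ) := by
  intro u hu
  refine ⟨fun ξ ζ hξ hζ => pairing_skew S hu hξ hζ a b, fun ξ₁ ξ₂ ξ₃ hξ₁ hξ₂ hξ₃ => ?_⟩
  let v : (ℝ → Coord N) → ℝ → Coord N := fun ξ => a • M1op η μ ψ u ξ + b • M2op η ξ
  have hv : ∀ ξ, IsTest ξ → ContDiff ℝ ∞ (v ξ) := fun ξ hξ =>
    ((contDiff_leftFactor S hu (contDiff_skewInt_rightFactor S hu hξ)).const_smul a).add
      ((contDiff_M2op hξ).const_smul b)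
  have hD := fun ξ ζ θ hξ hζ hθ =>
    hasDerivAt_pairing (v := v θ) (ξ := ξ) (ζ := ζ) S hu (hv θ hθ) hξ hζ a b
  obtain ⟨i1, d1⟩ := hD ξ₁ ξ₂ ξ₃ hξ₁ hξ₂ hξ₃
  obtain ⟨i2, d2⟩ := hD ξ₂ ξ₃ ξ₁ hξ₂ hξ₃ hξ₁
  obtain ⟨i3, d3⟩ := hD ξ₃ ξ₁ ξ₂ hξ₃ hξ₁ hξ₂
  refine ⟨_, _, _, d1, d2, d3, ?_⟩
  rw [← mul_add, ← mul_add, ← integral_add i1 i2, ← integral_add (i1.fun_add i2) i3]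
  have hP := fun ξ ζ θ hξ hζ hθ =>
    integrable_varPrimitive (v := v θ) (ξ := ξ) (ζ := ζ) S hu (hv θ hθ) hξ hζ
  -- The cyclic sum of densities is the derivative of the cyclic sum of primitives, since the
  -- remainders cancel pointwise; its integral is therefore zero.
  rw [integral_eq_zero_of_hasDerivAt_of_integrable (f := fun x =>
    varPrimitive η μ ψ u (v ξ₃) ξ₁ ξ₂ x + varPrimitive η μ ψ u (v ξ₁) ξ₂ ξ₃ x +
      varPrimitive η μ ψ u (v ξ₂) ξ₃ ξ₁ x) (fun x => ?_) ((i1.fun_add i2).fun_add i3)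
    (((hP ξ₁ ξ₂ ξ₃ hξ₁ hξ₂ hξ₃).add (hP ξ₂ ξ₃ ξ₁ hξ₂ hξ₃ hξ₁)).add
      (hP ξ₃ ξ₁ ξ₂ hξ₃ hξ₁ hξ₂)), mul_zero]
  refine (((hasDerivAt_varPrimitive S hu (hv ξ₃ hξ₃) hξ₁ hξ₂ x).add
    (hasDerivAt_varPrimitive S hu (hv ξ₁ hξ₁) hξ₂ hξ₃ x)).add
    (hasDerivAt_varPrimitive S hu (hv ξ₂ hξ₂) hξ₃ hξ₁ x)).congr_deriv ?_
  have hx := hu.2 x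
  have ev : ∀ ξ, v ξ x = a • (η *ᵥ (hessComb μ ψ u
      (fun n => skewInt (rightFactor η ψ u ξ n)) x *ᵥ deriv u x)) + b • (η *ᵥ deriv ξ x) :=
    fun ξ => congrArg (fun y => a • y + b • (η *ᵥ deriv ξ x)) (leftFactor_eq u _ x)
  have key := cyclic_sum_eq_zero (hessComb_isSymm S hx _) (hessComb_isSymm S hx _)
    (hessComb_isSymm S hx _)
    (hessComb_mul_comm S hx (fun n => skewInt (rightFactor η ψ u ξ₁ n))
      (fun n => skewInt (rightFactor η ψ u ξ₂ n)))
    (hessComb_mul_comm S hx _ (fun n => skewInt (rightFactor η ψ u ξ₃ n)))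
    (hessComb_mul_comm S hx _ _) a b (deriv u x) (η *ᵥ deriv ξ₁ x) (η *ᵥ deriv ξ₂ x)
    (η *ᵥ deriv ξ₃ x)
  simp only [← ev] at key
  linarith

end

end HydroHierarchy

/-! ### The main theorem. -/

open HydroHierarchy in
theorem mainTheorem5 {N L : ℕ}
    (η : Matrix (Fin N) (Fin N) ℝ) (hη : η.IsSymm) (hη' : η.det ≠ 0)
    (μ : Matrix (Fin L) (Fin L) ℝ) (hμ : μ.IsSymm) (hμ' : μ.det ≠ 0)
    (U : Set (Coord N)) (hU : IsOpen U)
    (ψ : Fin L → Coord N → ℝ) (hψ : ∀ n, ContDiffOn ℝ ∞ (ψ n) U)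
    (hcomm : CommutingHessians U η ψ) (hgauss : GaussEquations U μ ψ) :
    -- `M₁` and `M₂` are compatible Hamiltonian operators
    (∀ a b : ℝ, IsHamiltonian U (fun u ξ => a • M1op η μ ψ u ξ + b • M2op η ξ)) ∧
    -- on every convex open part of `U`, hence near every point of `U`:
    ∀ V ⊆ U, IsOpen V → Convex ℝ V →
      -- every step of the recursion is solvable, whatever choices were made before
      (∀ K F h, SolvesUpTo V η μ ψ K F h →
        (∃ G, SolvesF V η ψ (h (K + 1)) G) ∧
        ∀ G, SolvesF V η ψ (h (K + 1)) G → ∃ g, SolvesH V μ ψ G g) ∧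
      (∃ F h, SolvesRecursion V η μ ψ F h) ∧
      -- `R^s u_x` exists as a local expression for every `s`, and is always of hydrodynamic type
      (∀ s, (∃ Y, IsRPowValue V η μ ψ s Y) ∧
        ∀ Y, IsRPowValue V η μ ψ s Y →
          IsHydrodynamic V Y ∧ ∃ Y', IsRValue V η μ ψ Y Y') ∧
      -- for every solution of the recursion:
      ∀ F h, SolvesRecursion V η μ ψ F h →
        -- the flows are `u_{t_s} = R^s u_x = M₁ δH_s = M₂ δH_{s+1}`
        (∀ s, 1 ≤ s →
          IsRPowValue V η μ ψ s (flow η μ ψ (F s)) ∧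
          IsHydrodynamic V (flow η μ ψ (F s)) ∧
          IsM1Value V η μ ψ (varDeriv (h s)) (flow η μ ψ (F s)) ∧
          IsM2Value V η (varDeriv (h (s + 1))) (flow η μ ψ (F s))) ∧
        -- they commute, and the `H_s` are in involution for both brackets
        ∀ p r, 1 ≤ p → 1 ≤ r →
          FlowsCommute V (flow η μ ψ (F p)) (flow η μ ψ (F r)) ∧
          InInvolution V (IsM1Value V η μ ψ) (h p) (h r) ∧
          InInvolution V (IsM2Value V η) (h p) (h r) := by
  -- `Setting` does not contain convexity, so the Hamiltonian property is obtained on all of `U`;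
  -- convexity of `V` enters only through primitives and integration constants.
  have SU : Setting U η μ ψ := ⟨hη, hη', hμ, hU, hψ, hcomm, hgauss⟩
  refine ⟨fun a b => isHamiltonian SU a b, fun V hVU hV hc => ?_⟩
  have S : Setting V η μ ψ := ⟨hη, hη', hμ, hV, fun n => (hψ n).mono hVU,
    fun u hu => hcomm u (hVU hu), fun u hu => hgauss u (hVU hu)⟩
  refine ⟨fun K F h hs => ⟨(hs.admissible S le_rfl).exists_solvesF S hc,
      fun G hG => hG.exists_solvesH S hc⟩, exists_solvesRecursion S hc,
    fun s => ⟨exists_isRPowValue S hc s, fun Y hY => ⟨?_, isRPowValue_exists_isRValue S hc hY⟩⟩,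
    fun F h hs => ⟨fun s h1 => ?_, fun p r hp hr => ⟨?_, ?_, ?_⟩⟩⟩
  · obtain ⟨h, hh, e⟩ := isRPowValue_exists_density S hc s Y hY
    exact isHydrodynamic_of_density hV hh.1 e
  · have e : ∀ u, IsField V u → ∀ x, flow η μ ψ (F s) u x =
        η.mulVec ((hess (h (s + 1)) (u x)).mulVec (deriv u x)) :=
      fun u hu x => flow_eq (hs.solvesH h1) (hu.2 x)
    exact ⟨hs.isRPowValue S h1, isHydrodynamic_of_density hV (hs.solvesH h1).1 e,
      (hs.solvesF h1).isM1Value S fun _ _ _ => rfl, isM2Value_varDeriv hV (hs.solvesH h1).1 e⟩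
  -- The flow of `F p` is `η (∇h_{p+1})_x`, so the Hessians compared are those of `h (p + 1)` and `h
  -- (r + 1)`.
  · exact flowsCommute hV (hs.solvesH hp) (hs.solvesH hr)
      fun u hu => hs.hess_mul_comm S (by omega) (by omega) hu
  · exact inInvolution_M1 S hc (hs.solvesF hp) (hs.solvesF hr)
  · exact inInvolution_M2 hV hc hη (hs.admissible S hp).1 (hs.admissible S hr).1
      fun u hu => hs.hess_mul_comm S hp hr hu
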